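/- Let $d\ge 2$, let $\omega\subset\mathbb R^{d-1}$ be a bounded connected open set with Lipschitz boundary, and for $\varepsilon>0$ put $\Omega_\varepsilon=\omega\times(0,\varepsilon)\subset\mathbb R^d$. Write $x=(x',x_d)\in\mathbb R^{d-1}\times\mathbb R$, let $\sigma_d=\mathcal H^{d-1}(S^{d-1})$, and for $s\in(0,1)$ let $$\lfloor u\rfloor_s^2(\Omega_\varepsilon)=\int_{\Omega_\varepsilon\times\Omega_\varepsilon}\frac{|u(x)-u(y)|^2}{|x-y|^{d+2s}}\,dx\,dy ,\qquad H^s(\Omega_\varepsilon)=\{u\in L^2(\Omega_\varepsilon):\lfloor u\rfloor_s(\Omega_\varepsilon)<+\infty\}.$$ Say that $u_\varepsilon\in L^1_{\rm loc}(\Omega_\varepsilon)$ dimension-reduction converge in $L^1_{\rm loc}$ to $u\in L^1_{\rm loc}(\omega)$ if the scaled functions $v_\varepsilon(x',x_d)=u_\varepsilon(x',\varepsilon x_d)$ converge in $L^1_{\rm loc}(\omega\times(0,1))$ to $v(x',x_d)=u(x')$. Let $s_\varepsilon\to1^-$ as $\varepsilon\to0^+$, and let $F_\varepsilon(u)=\frac{1-s_\varepsilon}{\varepsilon^{3-2s_\varepsilon}}\lfloor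 u\rfloor_{s_\varepsilon}^2(\Omega_\varepsilon)$ if $u\in H^{s_\varepsilon}(\Omega_\varepsilon)$ and $F_\varepsilon(u)=+\infty$ otherwise. Then, with respect to dimension-reduction convergence in $L^1_{\rm loc}$, $$\Gamma\text{-}\lim_{\varepsilon\to0}F_\varepsilon(u)=\frac{\sigma_d}{2d}\int_\omega|\nabla'u|^2\,dx'\qquad\text{for all }u\in H^1(\omega).$$ That is, for every $u\in H^1(\omega)$ and every sequence $\varepsilon_j\to0$ of positive numbers: (i) $\liminf_{j}F_{\varepsilon_j}(u_j)\ge\frac{\sigma_d}{2d}\int_\omega|\nabla'u|^2dx'$ for every sequence $(u_j)$ which dimension-reduction converges in $L^1_{\rm loc}$ to $u$ along $(\varepsilon_j)$; (ii) there is a sequence $(u_j)$ which dimension-reduction converges in $L^1_{\rm loc}$ to $u$ along $(\varepsilon_j)$ and satisfies $\limsup_{j}F_{\varepsilon_j}(u_j)\le\frac{\sigma_d}{2d}\int_\omega|\nabla'u|^2dx'$. -/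

import Mathlib

open Set Filter Topology MeasureTheory
open scoped ENNReal

noncomputable section

namespace ThinFilm

/-- The space `ℝ^{d-1}` of the planar variables `x'`, with its Euclidean norm. -/
abbrev Planar (d : ℕ) : Type := EuclideanSpace ℝ (Fin (d - 1))

/-- The space `ℝ^d = ℝ^{d-1} × ℝ` of points `x = (x', x_d)`. Its canonical measure is Lebesgue
measure. The distance that Mathlib puts on a product is the maximum distance, which is never used
below for a metric purpose; the Euclidean distance is `euclDist`. -/
abbrev Full (d : ℕ) : Type := Planar d × ℝ

/-- The Euclidean distance `|x - y|` in `ℝ^d = ℝ^{d-1} × ℝ`. -/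
def euclDist {d : ℕ} (x y : Full d) : ℝ :=
  Real.sqrt (‖x.1 - y.1‖ ^ 2 + (x.2 - y.2) ^ 2)

/-- The cylinder `Ω_ε = ω × (0, ε)`. -/
def film {d : ℕ} (ω : Set (Planar d)) (ε : ℝ) : Set (Full d) := ω ×ˢ Ioo 0 ε

/-- The surface measure `σ_d` of the unit sphere of `ℝ^d`. -/
def sphereArea (d : ℕ) : ℝ :=
  (volume : Measure (EuclideanSpace ℝ (Fin d))).toSphere.real univ

/-- `ω` has Lipschitz boundary: near each of its boundary points, `ω` is the strict epigraph,
in some direction `e`, of a Lipschitz function of the component orthogonal to `e`. -/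
def HasLipschitzBoundary {d : ℕ} (ω : Set (Planar d)) : Prop :=
  ∀ x₀ ∈ frontier ω, ∃ r > 0, ∃ e : Planar d, ‖e‖ = 1 ∧
    ∃ (K : NNReal) (g : Planar d → ℝ), LipschitzWith K g ∧
      ∀ x ∈ Metric.ball x₀ r, (x ∈ ω ↔ g (x - inner ℝ e x • e) < inner ℝ e x)

/-- The squared Gagliardo seminorm
`∫_{Ω × Ω} |u(x) - u(y)|² / |x - y|^{d + 2s} dx dy`, with values in `[0, ∞]`. -/
def gagliardoSq {d : ℕ} (s : ℝ) (Ω : Set (Full d)) (u : Full d → ℝ) : ℝ≥0∞ :=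
  ∫⁻ p in Ω ×ˢ Ω,
    ENNReal.ofReal ((u p.1 - u p.2) ^ 2 / euclDist p.1 p.2 ^ ((d : ℝ) + 2 * s))

/-- `u ∈ H^s(Ω)`. -/
def MemHs {d : ℕ} (s : ℝ) (Ω : Set (Full d)) (u : Full d → ℝ) : Prop :=
  MemLp u 2 (volume.restrict Ω) ∧ gagliardoSq s Ω u < ⊤

open Classical in
/-- The functional `u ↦ (1 - s) ε^{-(3 - 2s)} ⌊u⌋²_s(Ω_ε)` on `H^s(Ω_ε)`, extended by `+∞`. -/
def scaledEnergy {d : ℕ} (ω : Set (Planar d)) (s ε : ℝ) (u : Full d → ℝ) : ℝ≥0∞ :=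
  if MemHs s (film ω ε) u then
    ENNReal.ofReal ((1 - s) / ε ^ (3 - 2 * s)) * gagliardoSq s (film ω ε) u
  else ⊤

/-- `u ∈ H¹(ω)` with distributional gradient `G = ∇'u` on `ω`. -/
structure IsH1WithGradient {d : ℕ} (ω : Set (Planar d)) (u : Planar d → ℝ)
    (G : Planar d → Planar d) : Prop where
  memLp : MemLp u 2 (volume.restrict ω)
  memLp_gradient : MemLp G 2 (volume.restrict ω)
  integral_eq : ∀ φ : Planar d → ℝ, ContDiff ℝ (⊤ : ℕ∞) φ → HasCompactSupport φ → tsupport φ ⊆ ω →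
    ∀ v : Planar d,
      ∫ x in ω, u x * fderiv ℝ φ x v = - ∫ x in ω, inner ℝ (G x) v * φ x

/-- The scaled function `v_ε(x', x_d) = u_ε(x', ε x_d)`. -/
def rescale {d : ℕ} (ε : ℝ) (u : Full d → ℝ) : Full d → ℝ := fun x => u (x.1, ε * x.2)

/-- Dimension-reduction convergence in `L¹_loc`, along a sequence of thicknesses `ε j`, of
functions `U j ∈ L¹_loc(Ω_{ε j})` to `u ∈ L¹_loc(ω)`: the scaled functions converge in `L¹` on
every compact subset of `ω × (0, 1)` to the function `x ↦ u(x')`. -/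
structure DRConvL1loc {d : ℕ} (ω : Set (Planar d)) (ε : ℕ → ℝ) (U : ℕ → Full d → ℝ)
    (u : Planar d → ℝ) : Prop where
  locallyIntegrable : ∀ j, LocallyIntegrableOn (U j) (film ω (ε j))
  locallyIntegrable_limit : LocallyIntegrableOn u ω
  tendsto : ∀ K : Set (Full d), IsCompact K → K ⊆ film ω 1 →
    Tendsto (fun j => ∫⁻ x in K, ‖rescale (ε j) (U j) x - u x.1‖ₑ) atTop (𝓝 0)

/-- `Γ-lim_{ε → 0⁺} F ε = L` at the point `y`, with respect to the convergence `conv`: along every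
sequence of positive numbers tending to `0`, the liminf inequality holds at `y` with bound `L` and
there is a recovery sequence for it. -/
def IsGammaLimitAt {X Y : Type*} (conv : (ℕ → ℝ) → (ℕ → X) → Y → Prop)
    (F : ℝ → X → ℝ≥0∞) (y : Y) (L : ℝ≥0∞) : Prop :=
  ∀ ε : ℕ → ℝ, (∀ j, 0 < ε j) → Tendsto ε atTop (𝓝 0) →
    (∀ U : ℕ → X, conv ε U y → L ≤ liminf (fun j => F (ε j) (U j)) atTop) ∧
    (∃ U : ℕ → X, conv ε U y ∧ limsup (fun j => F (ε j) (U j)) atTop ≤ L)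

end ThinFilm

end

/-! With y = x + h the seminorm becomes the integral over h of |h|^{-d-2s} times the squared L²
increment of u by h (`gagliardoSq_eq_lintegral_incrSq`). On a ball of radius cε the kernel sends ⟨a,
h'⟩² to (σ_d/d) (cε)^{2-2s}/(2-2s) times |a|² (`setLIntegral_inner_sq_div`). A planar function
contributes one more factor ε from the thickness, so multiplication by (1-s)/ε^{3-2s} removes every
power of ε and leaves c^{2-2s} σ_d/(2d), which tends to σ_d/(2d) as s → 1. No relation between the
rates of s_ε and ε is needed.

Lower bound. The functions U may depend on x_d, and the translation by h moves the slab of heights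
on which U is known to be close to u. Composing the increment by h = (h', h_d) with the one by (h',
-h_d) gives the planar increment by 2h', which preserves the slab; the kernel does not see the
reflection, so this costs only a constant, and that constant is exact
(`setLIntegral_planar_increment_le`, `setLIntegral_kernel_mul_incrSq_add_flip_le`). Planar
increments are bounded below by duality: they are tested with 2⟨Ψ, h'⟩, where Ψ is smooth, compactly
supported in ω and L²-close to ∇'u; the difference is moved to Ψ, U is replaced by u, and the weak
gradient is used (`le_integral_planar_increment`). All errors are small multiples of |h'|², so they
survive integration against the kernel over |h| < δε (`le_mul_gagliardoSq`). The thickness tends to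
0 first, then the error, then δ.

Upper bound. For v smooth with compact support, the function v(x') is tried. For |h| < 2ε, Taylor
expansion gives the Dirichlet integral. For |h| ≥ 2ε, both points can lie in the film only if |h_d|
< ε, hence |h'| ≥ ε; this part has order ε^{3-2s} with no factor 1/(1-s), so it disappears after
scaling (`mul_gagliardoSq_comp_fst_le`). A general u is reached by a diagonal argument, since
restrictions of smooth functions are dense in H¹(ω) (`exists_contDiff_eLpNorm_grad_sub_le`). The
regularity of the boundary enters only here: in each chart of the boundary the mollifier is shifted
so that it reads values inside ω only (`exists_mollifier`). -/

noncomputable section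

namespace ThinFilm

/-! ### Radial integrals in polar coordinates. -/

section Radial

variable {V : Type*} [NormedAddCommGroup V] [NormedSpace ℝ V] [MeasurableSpace V] [BorelSpace V]
  [FiniteDimensional ℝ V]

/-- Integration of a radial function in polar coordinates. -/
lemma lintegral_fun_norm_addHaar [Nontrivial V] (μ : Measure V) [μ.IsAddHaarMeasure]
    {f : ℝ → ℝ≥0∞} (hf : Measurable f) :
    ∫⁻ x, f ‖x‖ ∂μ = μ.toSphere univ *
      ∫⁻ r in Ioi (0 : ℝ), ENNReal.ofReal (r ^ (Module.finrank ℝ V - 1)) * f r := by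
  have hm : Measurable fun r : Ioi (0 : ℝ) => f r := hf.comp measurable_subtype_coe
  calc
    ∫⁻ x, f ‖x‖ ∂μ = ∫⁻ x : ({(0)}ᶜ : Set V), f ‖x.1‖ ∂(μ.comap (↑)) := by
      rw [lintegral_subtype_comap (measurableSet_singleton _).compl fun x ↦ f (‖x‖),
        restrict_compl_singleton]
    _ = ∫⁻ x, f x.2 ∂μ.toSphere.prod (.volumeIoiPow (Module.finrank ℝ V - 1)) := by
      simpa using μ.measurePreserving_homeomorphUnitSphereProd.lintegral_comp_emb
        (Homeomorph.measurableEmbedding _) (f ∘ Subtype.val ∘ Prod.snd)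
    _ = μ.toSphere univ * ∫⁻ x : Ioi (0 : ℝ), f x ∂.volumeIoiPow (Module.finrank ℝ V - 1) := by
      rw [lintegral_prod (fun x : _ × Ioi (0 : ℝ) => f x.2) (hm.comp measurable_snd).aemeasurable]
      simp [mul_comm]
    _ = _ := by
      rw [Measure.volumeIoiPow, lintegral_withDensity_eq_lintegral_mul _ (by fun_prop) hm]
      rw [← lintegral_subtype_comap measurableSet_Ioi]
      rfl

/-- The radial density is r^{n-1} r^{2-n-2s} = r^{1-2s}, integrable at 0 because s < 1. The
resulting 1/(2-2s) is the singularity that the prefactor 1-s of the energy compensates. -/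
lemma setLIntegral_ball_rpow [Nontrivial V] (μ : Measure V) [μ.IsAddHaarMeasure]
    {s R : ℝ} (hs : s < 1) (hR : 0 < R) :
    ∫⁻ x in Metric.ball 0 R, ENNReal.ofReal
        (‖x‖ ^ 2 / ‖x‖ ^ ((Module.finrank ℝ V : ℝ) + 2 * s)) ∂μ =
      μ.toSphere univ * ENNReal.ofReal (R ^ (2 - 2 * s) / (2 - 2 * s)) := by
  set n := Module.finrank ℝ V
  have hn : 0 < n := Module.finrank_pos
  have h1 : ∫⁻ x in Metric.ball 0 R, ENNReal.ofReal
        (‖x‖ ^ 2 / ‖x‖ ^ ((n : ℝ) + 2 * s)) ∂μ =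
      ∫⁻ x, (Iio R).indicator
        (fun r : ℝ => ENNReal.ofReal (r ^ 2 / r ^ ((n : ℝ) + 2 * s))) ‖x‖ ∂μ := by
    rw [← lintegral_indicator measurableSet_ball]
    congr with x
    simp [indicator]
  rw [h1, lintegral_fun_norm_addHaar μ (Measurable.indicator (by fun_prop) measurableSet_Iio)]
  congr 1
  have h2 : ∀ r ∈ Ioi (0 : ℝ), ENNReal.ofReal (r ^ (n - 1)) * (Iio R).indicator
        (fun r : ℝ => ENNReal.ofReal (r ^ 2 / r ^ ((n : ℝ) + 2 * s))) r =
      (Iio R).indicator (fun r : ℝ => ENNReal.ofReal (r ^ (1 - 2 * s))) r := by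
    intro r hr
    have hr : 0 < r := hr
    by_cases h : r < R
    · simp only [mem_Iio, h, indicator_of_mem]
      rw [← ENNReal.ofReal_mul (by positivity)]
      congr 1
      rw [← Real.rpow_natCast, ← Real.rpow_natCast r 2, ← Real.rpow_sub hr, ← Real.rpow_add hr,
        Nat.cast_sub hn]
      congr 1
      push_cast
      ring
    · simp [h]
  rw [setLIntegral_congr_fun measurableSet_Ioi h2, setLIntegral_indicator measurableSet_Iio,
    inter_comm, Ioi_inter_Iio, Measure.restrict_congr_set Ioo_ae_eq_Ioc]
  rw [← ofReal_integral_eq_lintegral_ofReal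
    (intervalIntegral.intervalIntegrable_rpow' (by linarith)).1]
  · rw [← intervalIntegral.integral_of_le hR.le, integral_rpow (Or.inl (by linarith)),
      Real.zero_rpow (by linarith)]
    congr 1
    ring_nf
  · filter_upwards [ae_restrict_mem measurableSet_Ioc] with r hr
    exact Real.rpow_nonneg hr.1.le _

/-- The exponent is normalized so that the radial density is r^{-p}. It serves with n = d-1 and p =
2s, for the far part of the energy of planar functions. -/
lemma setLIntegral_compl_ball_rpow [Nontrivial V] (μ : Measure V) [μ.IsAddHaarMeasure]
    {p R : ℝ} (hp : 1 < p) (hR : 0 < R) :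
    ∫⁻ x in {x | R ≤ ‖x‖}, ENNReal.ofReal
        (‖x‖ ^ (1 - (Module.finrank ℝ V : ℝ) - p)) ∂μ =
      μ.toSphere univ * ENNReal.ofReal (R ^ (1 - p) / (p - 1)) := by
  set n := Module.finrank ℝ V
  have hn : 0 < n := Module.finrank_pos
  have h1 : ∫⁻ x in {x | R ≤ ‖x‖}, ENNReal.ofReal (‖x‖ ^ (1 - (n : ℝ) - p)) ∂μ =
      ∫⁻ x, (Ici R).indicator
        (fun r : ℝ => ENNReal.ofReal (r ^ (1 - (n : ℝ) - p))) ‖x‖ ∂μ := by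
    rw [← lintegral_indicator (measurableSet_le measurable_const measurable_norm)]
    congr with x
  rw [h1, lintegral_fun_norm_addHaar μ (Measurable.indicator (by fun_prop) measurableSet_Ici)]
  congr 1
  have h2 : ∀ r ∈ Ioi (0 : ℝ), ENNReal.ofReal (r ^ (n - 1)) * (Ici R).indicator
        (fun r : ℝ => ENNReal.ofReal (r ^ (1 - (n : ℝ) - p))) r =
      (Ici R).indicator (fun r : ℝ => ENNReal.ofReal (r ^ (-p))) r := by
    intro r hr
    have hr : 0 < r := hr
    by_cases h : R ≤ r
    · simp only [mem_Ici, h, indicator_of_mem]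
      rw [← ENNReal.ofReal_mul (by positivity)]
      congr 1
      rw [← Real.rpow_natCast, ← Real.rpow_add hr, Nat.cast_sub hn]
      congr 1
      push_cast
      ring
    · simp [h]
  have h3 : Ici R ∩ Ioi (0 : ℝ) = Ici R :=
    inter_eq_left.2 fun r (hr : R ≤ r) => hR.trans_le hr
  rw [setLIntegral_congr_fun measurableSet_Ioi h2, setLIntegral_indicator measurableSet_Ici,
    h3, ← Measure.restrict_congr_set Ioi_ae_eq_Ici]
  rw [← ofReal_integral_eq_lintegral_ofReal
    (integrableOn_Ioi_rpow_of_lt (by linarith) hR)]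
  · rw [integral_Ioi_rpow_of_lt (by linarith) hR]
    congr 1
    rw [show -p + 1 = -(p - 1) by ring, neg_div_neg_eq]
    ring_nf
  · filter_upwards [ae_restrict_mem measurableSet_Ioi] with r hr
    exact Real.rpow_nonneg (hR.trans hr).le _

end Radial

/-! ### Squares of linear forms against radial weights. -/

section Quadratic

variable {V : Type*} [NormedAddCommGroup V] [InnerProductSpace ℝ V] [MeasurableSpace V]
  [BorelSpace V] [FiniteDimensional ℝ V]

/-- A radial weight integrates the square of a linear form to a multiple of its norm. -/
lemma lintegral_inner_sq_mul_radial (w : ℝ → ℝ≥0∞) (hw : Measurable w)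
    (a : V) :
    Module.finrank ℝ V * ∫⁻ x : V, ENNReal.ofReal (inner ℝ a x ^ 2) * w ‖x‖ =
      ENNReal.ofReal (‖a‖ ^ 2) * ∫⁻ x : V, ENNReal.ofReal (‖x‖ ^ 2) * w ‖x‖ := by
  have rot : ∀ a b : V, ‖a‖ = ‖b‖ → ∫⁻ x : V, ENNReal.ofReal (inner ℝ a x ^ 2) * w ‖x‖ =
      ∫⁻ x : V, ENNReal.ofReal (inner ℝ b x ^ 2) * w ‖x‖ := by
    intro a b hab
    -- The reflection that exchanges two vectors of equal norm preserves both Lebesgue measure and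
    -- the radial weight, so the integral depends on a only through its norm.
    let T : V ≃ₗᵢ[ℝ] V := Submodule.reflection (ℝ ∙ (a - b))ᗮ
    have hT : T a = b := Submodule.reflection_sub hab
    rw [← T.measurePreserving.lintegral_comp_emb T.toMeasurableEquiv.measurableEmbedding
      (fun x => ENNReal.ofReal (inner ℝ b x ^ 2) * w ‖x‖)]
    congr with x
    rw [← hT, LinearIsometryEquiv.inner_map_map, LinearIsometryEquiv.norm_map]
  let e := stdOrthonormalBasis ℝ V
  -- Comparing a with each vector of an orthonormal basis and summing, the squared coordinates add
  -- up to the squared norm; the dimension appears as the number of comparisons.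
  have key : ∀ i, ∫⁻ x : V, ENNReal.ofReal (inner ℝ a x ^ 2) * w ‖x‖ =
      ENNReal.ofReal (‖a‖ ^ 2) * ∫⁻ x : V, ENNReal.ofReal (inner ℝ (e i) x ^ 2) * w ‖x‖ := by
    intro i
    rw [rot a (‖a‖ • e i) (by simp [norm_smul]), ← lintegral_const_mul _ (by fun_prop)]
    congr with x
    rw [← mul_assoc, ← ENNReal.ofReal_mul (by positivity), inner_smul_left]
    congr 2
    simp [mul_pow]
  calc _ = ∑ i, ∫⁻ x : V, ENNReal.ofReal (inner ℝ a x ^ 2) * w ‖x‖ := by simp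
    _ = ∑ i, ENNReal.ofReal (‖a‖ ^ 2) *
        ∫⁻ x : V, ENNReal.ofReal (inner ℝ (e i) x ^ 2) * w ‖x‖ :=
      Finset.sum_congr rfl fun i _ => key i
    _ = _ := by
      rw [← Finset.mul_sum, ← lintegral_finsetSum _ (by fun_prop)]
      congr with x
      rw [← Finset.sum_mul, ← ENNReal.ofReal_sum_of_nonneg (fun i _ => by positivity),
        ← e.sum_sq_inner_right x]

lemma setLIntegral_ball_inner_sq [Nontrivial V] (a : V) {s R : ℝ} (hs : s < 1) (hR : 0 < R) :
    Module.finrank ℝ V * ∫⁻ x : V in Metric.ball 0 R, ENNReal.ofReal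
        (inner ℝ a x ^ 2 / ‖x‖ ^ ((Module.finrank ℝ V : ℝ) + 2 * s)) =
      ENNReal.ofReal (‖a‖ ^ 2) * ((volume : Measure V).toSphere univ *
        ENNReal.ofReal (R ^ (2 - 2 * s) / (2 - 2 * s))) := by
  rw [← setLIntegral_ball_rpow volume hs hR]
  set q := (Module.finrank ℝ V : ℝ) + 2 * s
  let w : ℝ → ℝ≥0∞ := (Iio R).indicator fun r => ENNReal.ofReal ((r ^ q)⁻¹)
  have hw : Measurable w := Measurable.indicator (by fun_prop) measurableSet_Iio
  have h : ∀ f : V → ℝ, (∀ x, 0 ≤ f x) → ∫⁻ x in Metric.ball 0 R, ENNReal.ofReal (f x / ‖x‖ ^ q) =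
      ∫⁻ x, ENNReal.ofReal (f x) * w ‖x‖ := by
    intro f hf
    rw [← lintegral_indicator measurableSet_ball]
    congr with x
    by_cases hx : ‖x‖ < R
    · simp [w, hx, div_eq_mul_inv, ENNReal.ofReal_mul (hf x)]
    · simp [w, hx]
  rw [h _ fun x => sq_nonneg _, h _ fun x => sq_nonneg _, lintegral_inner_sq_mul_radial w hw]

end Quadratic

/-! ### The Euclidean norm on the product and integrals of the kernel. -/

section Film

variable {d : ℕ}

/-- The Euclidean norm on `ℝ^d = ℝ^{d-1} × ℝ`. -/
def euclNorm (h : Full d) : ℝ := Real.sqrt (‖h.1‖ ^ 2 + h.2 ^ 2)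

lemma euclNorm_eq_norm_toLp (h : Full d) : euclNorm h = ‖WithLp.toLp 2 h‖ := by
  simp [euclNorm, WithLp.prod_norm_eq_of_L2]

@[fun_prop]
lemma continuous_euclNorm : Continuous (euclNorm (d := d)) := by
  unfold euclNorm
  fun_prop

@[fun_prop]
lemma measurable_euclNorm : Measurable (euclNorm (d := d)) := continuous_euclNorm.measurable

lemma euclNorm_nonneg (h : Full d) : 0 ≤ euclNorm h := Real.sqrt_nonneg _

lemma euclNorm_neg (h : Full d) : euclNorm (-h) = euclNorm h := by simp [euclNorm]

lemma norm_fst_le_euclNorm (h : Full d) : ‖h.1‖ ≤ euclNorm h :=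
  Real.le_sqrt_of_sq_le (by nlinarith [sq_nonneg h.2])

lemma abs_snd_le_euclNorm (h : Full d) : |h.2| ≤ euclNorm h :=
  Real.le_sqrt_of_sq_le (by rw [sq_abs]; nlinarith [sq_nonneg ‖h.1‖])

lemma finrank_withLp_full (hd : 1 ≤ d) : Module.finrank ℝ (WithLp 2 (Full d)) = d := by
  rw [(WithLp.linearEquiv 2 ℝ (Full d)).finrank_eq]
  simp [hd]

/-- An orthonormal basis identifies the L² product isometrically with the standard Euclidean space,
and the sphere measure is determined by the dimension and the volume of the unit ball. -/
lemma toSphere_univ_withLp (hd : 1 ≤ d) :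
    (volume : Measure (WithLp 2 (Full d))).toSphere univ = ENNReal.ofReal (sphereArea d) := by
  have hb := ((stdOrthonormalBasis ℝ (WithLp 2 (Full d))).reindex
    (finCongr (finrank_withLp_full hd))).measurePreserving_repr
  have hv : volume (Metric.ball (0 : WithLp 2 (Full d)) 1) =
      volume (Metric.ball (0 : EuclideanSpace ℝ (Fin d)) 1) := by
    rw [← hb.measure_preimage measurableSet_ball.nullMeasurableSet,
      LinearIsometryEquiv.preimage_ball]
    simp
  rw [sphereArea, Measure.real, ENNReal.ofReal_toReal (measure_ne_top _ _)]
  simp only [Measure.toSphere_apply_univ, hv, finrank_withLp_full hd, finrank_euclideanSpace,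
    Fintype.card_fin]

lemma sphereArea_nonneg : 0 ≤ sphereArea d := measureReal_nonneg

/-- Transfers integrals from the product, which carries the maximum norm, to the inner product space
where the radial lemmas apply. -/
lemma setLIntegral_full (f : WithLp 2 (Full d) → ℝ≥0∞) (R : ℝ) :
    ∫⁻ h : Full d in {h | euclNorm h < R}, f (WithLp.toLp 2 h) =
      ∫⁻ x in Metric.ball 0 R, f x := by
  rw [← (WithLp.volume_preserving_toLp (Planar d) ℝ).setLIntegral_comp_preimage_emb
    (MeasurableEquiv.toLp 2 (Full d)).measurableEmbedding]
  congr! 2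
  ext h
  simp [euclNorm_eq_norm_toLp]

/-- The kernel `|h|^{-d-2s}` on small balls acts on squares of planar linear forms as a multiple of
the squared norm. -/
lemma setLIntegral_inner_sq_div (hd : 1 ≤ d) (a : Planar d) {s R : ℝ} (hs : s < 1) (hR : 0 < R) :
    ∫⁻ h : Full d in {h | euclNorm h < R},
        ENNReal.ofReal (inner ℝ a h.1 ^ 2 / euclNorm h ^ ((d : ℝ) + 2 * s)) =
      ENNReal.ofReal (sphereArea d / d * (R ^ (2 - 2 * s) / (2 - 2 * s))) *
        ENNReal.ofReal (‖a‖ ^ 2) := by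
  have hfr := finrank_withLp_full hd
  have : Nontrivial (WithLp 2 (Full d)) := Module.nontrivial_of_finrank_pos (R := ℝ) (by omega)
  have key := setLIntegral_ball_inner_sq (V := WithLp 2 (Full d)) (WithLp.toLp 2 (a, (0 : ℝ))) hs hR
  rw [hfr, toSphere_univ_withLp hd, ← setLIntegral_full] at key
  have hn : ‖WithLp.toLp 2 (a, (0 : ℝ))‖ = ‖a‖ := by simp
  simp only [WithLp.prod_inner_apply, hn, ← euclNorm_eq_norm_toLp] at key
  have hd0 : (0 : ℝ) < d := by exact_mod_cast hd
  have h2 : (0 : ℝ) < 2 - 2 * s := by linarith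
  have hc : ENNReal.ofReal (sphereArea d / d * (R ^ (2 - 2 * s) / (2 - 2 * s))) =
      (d : ℝ≥0∞)⁻¹ * (ENNReal.ofReal (sphereArea d) *
        ENNReal.ofReal (R ^ (2 - 2 * s) / (2 - 2 * s))) := by
    rw [ENNReal.ofReal_mul (by have := @sphereArea_nonneg d; positivity),
      ENNReal.ofReal_div_of_pos hd0, ENNReal.ofReal_natCast, ENNReal.div_eq_inv_mul, mul_assoc]
  rw [hc, mul_assoc, mul_comm _ (ENNReal.ofReal (‖a‖ ^ 2)), ← key, ← mul_assoc,
    ENNReal.inv_mul_cancel (by positivity) (by simp), one_mul]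
  simp

/-- Controls the error terms: an error bounded by a small multiple of |h'|² stays small after
integration against the kernel and multiplication by 1-s. -/
lemma setLIntegral_norm_sq_div_le (hd : 1 ≤ d) {s R : ℝ} (hs : s < 1) (hR : 0 < R) :
    ∫⁻ h : Full d in {h | euclNorm h < R},
        ENNReal.ofReal (‖h.1‖ ^ 2 / euclNorm h ^ ((d : ℝ) + 2 * s)) ≤
      ENNReal.ofReal (sphereArea d * (R ^ (2 - 2 * s) / (2 - 2 * s))) := by
  have hfr := finrank_withLp_full hd
  have : Nontrivial (WithLp 2 (Full d)) := Module.nontrivial_of_finrank_pos (R := ℝ) (by omega)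
  have key := setLIntegral_ball_rpow (V := WithLp 2 (Full d)) volume hs hR
  rw [hfr, toSphere_univ_withLp hd, ← setLIntegral_full,
    ← ENNReal.ofReal_mul sphereArea_nonneg] at key
  rw [← key]
  refine lintegral_mono fun h => ENNReal.ofReal_le_ofReal ?_
  simp only [← euclNorm_eq_norm_toLp]
  have := euclNorm_nonneg h
  gcongr
  exact norm_fst_le_euclNorm h

/-- The tail of the kernel `|h'|^{2-d-2s}` on `ℝ^{d-1}`. -/
lemma exists_setLIntegral_tail_le (hd : 2 ≤ d) : ∃ C : ℝ, 0 ≤ C ∧ ∀ s ε : ℝ, 3 / 4 ≤ s → 0 < ε →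
    ∫⁻ y : Planar d in {y | ε ≤ ‖y‖}, ENNReal.ofReal (‖y‖ ^ (2 - (d : ℝ) - 2 * s)) ≤
      ENNReal.ofReal (C * ε ^ (1 - 2 * s)) := by
  have hfr : Module.finrank ℝ (Planar d) = d - 1 := by simp
  have : Nontrivial (Planar d) := Module.nontrivial_of_finrank_pos (R := ℝ) (by omega)
  -- For s ≥ 3/4 the factor 1/(2s-1) is at most 2, which makes the constant independent of s.
  refine ⟨2 * (volume : Measure (Planar d)).toSphere.real univ, by positivity,
    fun s ε hs hε => ?_⟩
  have key := setLIntegral_compl_ball_rpow (V := Planar d) volume (p := 2 * s) (by linarith) hε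
  have hc : ((d - 1 : ℕ) : ℝ) = d - 1 := by push_cast [show 1 ≤ d by omega]; ring
  rw [hfr, hc, ← ofReal_measureReal, ← ENNReal.ofReal_mul measureReal_nonneg] at key
  rw [show 2 - (d : ℝ) - 2 * s = 1 - (d - 1) - 2 * s by ring, key]
  apply ENNReal.ofReal_le_ofReal
  have h : ε ^ (1 - 2 * s) / (2 * s - 1) ≤ 2 * ε ^ (1 - 2 * s) := by
    rw [div_le_iff₀ (by linarith)]
    nlinarith [Real.rpow_pos_of_pos hε (1 - 2 * s)]
  calc _ ≤ (volume : Measure (Planar d)).toSphere.real univ * (2 * ε ^ (1 - 2 * s)) := by gcongr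
    _ = _ := by ring

end Film

/-! ### Increments, the reflection of the last variable, and dilation. -/

section Gagliardo

variable {d : ℕ}

instance : (volume : Measure (Full d)).IsAddHaarMeasure :=
  inferInstanceAs ((volume : Measure (Planar d)).prod (volume : Measure ℝ)).IsAddHaarMeasure

/-- The squared `L²` norm of the increment `u(x + h) - u(x)` over the points `x` for which both
`x` and `x + h` lie in `Ω`. -/
def incrSq (Ω : Set (Full d)) (u : Full d → ℝ) (h : Full d) : ℝ≥0∞ :=
  ∫⁻ x in Ω ∩ (fun x => x + h) ⁻¹' Ω, ENNReal.ofReal ((u (x + h) - u x) ^ 2)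

/-- The kernel `|h|^{-d-2s}`. -/
def kernel (s : ℝ) (h : Full d) : ℝ≥0∞ :=
  ENNReal.ofReal ((euclNorm h ^ ((d : ℝ) + 2 * s))⁻¹)

@[fun_prop]
lemma measurable_kernel (s : ℝ) : Measurable (kernel (d := d) s) := by
  unfold kernel
  fun_prop

lemma kernel_neg (s : ℝ) (h : Full d) : kernel s (-h) = kernel s h := by
  rw [kernel, kernel, euclNorm_neg]

lemma ofReal_div_euclNorm (a : ℝ) (s : ℝ) (h : Full d) :
    ENNReal.ofReal (a / euclNorm h ^ ((d : ℝ) + 2 * s)) = kernel s h * ENNReal.ofReal a := by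
  rw [kernel, div_eq_inv_mul, ENNReal.ofReal_mul
    (inv_nonneg.2 (Real.rpow_nonneg (euclNorm_nonneg h) _))]

/-- Allows the competitor in the lower bound to be replaced by a Borel representative. -/
lemma gagliardoSq_congr_ae {s : ℝ} {Ω : Set (Full d)} {u v : Full d → ℝ}
    (huv : u =ᵐ[volume.restrict Ω] v) : gagliardoSq s Ω u = gagliardoSq s Ω v := by
  unfold gagliardoSq
  rw [Measure.volume_eq_prod, ← Measure.prod_restrict]
  refine lintegral_congr_ae ?_
  filter_upwards [Measure.quasiMeasurePreserving_fst.ae_eq_comp huv,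
    Measure.quasiMeasurePreserving_snd.ae_eq_comp huv] with p h1 h2
  simp only [Function.comp_apply] at h1 h2
  rw [h1, h2]

/-- The integrand is the composition of a measurable function on pairs, cut off to Ω × Ω, with (x,
h) ↦ (x, x + h); measurability in h is then that of a parametric integral. -/
lemma measurable_incrSq {Ω : Set (Full d)} (hΩ : MeasurableSet Ω) {u : Full d → ℝ}
    (hu : Measurable u) : Measurable (incrSq Ω u) := by
  have : incrSq Ω u = fun h => ∫⁻ x, (Ω ×ˢ Ω).indicator
      (fun p : Full d × Full d => ENNReal.ofReal ((u p.2 - u p.1) ^ 2)) (x, x + h) := by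
    ext h
    rw [incrSq, ← lintegral_indicator (hΩ.inter (measurable_add_const h hΩ))]
    congr with x
  rw [this]
  refine Measurable.lintegral_prod_right' (f := fun q : Full d × Full d => (Ω ×ˢ Ω).indicator
      (fun p : Full d × Full d => ENNReal.ofReal ((u p.2 - u p.1) ^ 2)) (q.2, q.2 + q.1)) ?_
  exact (Measurable.indicator (by fun_prop) (hΩ.prod hΩ)).comp (by fun_prop)

/-- The Gagliardo seminorm as a weighted integral of the increments. -/
lemma gagliardoSq_eq_lintegral_incrSq {s : ℝ} {Ω : Set (Full d)} (hΩ : MeasurableSet Ω)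
    {u : Full d → ℝ} (hu : Measurable u) :
    gagliardoSq s Ω u = ∫⁻ h, kernel s h * incrSq Ω u h := by
  set F : Full d × Full d → ℝ≥0∞ := (Ω ×ˢ Ω).indicator (fun p =>
    ENNReal.ofReal ((u p.1 - u p.2) ^ 2 / euclNorm (p.1 - p.2) ^ ((d : ℝ) + 2 * s)))
  have hF : Measurable F := by
    refine Measurable.indicator ?_ (hΩ.prod hΩ)
    have : Measurable fun p : Full d × Full d => euclNorm (p.1 - p.2) :=
      measurable_euclNorm.comp (by fun_prop)
    fun_prop
  calc gagliardoSq s Ω u = ∫⁻ p, F p := by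
        rw [gagliardoSq, ← lintegral_indicator (hΩ.prod hΩ)]
        rfl
    _ = ∫⁻ x, ∫⁻ y, F (x, y) := by
        rw [Measure.volume_eq_prod, lintegral_prod _ hF.aemeasurable]
    _ = ∫⁻ x, ∫⁻ h, F (x, x + h) := by
        congr with x
        exact (lintegral_add_left_eq_self (fun y => F (x, y)) x).symm
    _ = ∫⁻ h, ∫⁻ x, F (x, x + h) :=
        lintegral_lintegral_swap (hF.comp (by fun_prop)).aemeasurable
    _ = _ := by
        congr with h
        rw [incrSq, ← lintegral_indicator (hΩ.inter (measurable_add_const h hΩ)),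
          ← lintegral_const_mul _ (Measurable.indicator (by fun_prop)
            (hΩ.inter (measurable_add_const h hΩ)))]
        congr with x
        by_cases hx : x ∈ Ω ∧ x + h ∈ Ω
        · have h1 : (x, x + h) ∈ Ω ×ˢ Ω := hx
          have h2 : x ∈ Ω ∩ (fun x => x + h) ⁻¹' Ω := hx
          rw [indicator_of_mem h2]
          simp only [F]
          rw [indicator_of_mem h1, ofReal_div_euclNorm]
          have hk : kernel s (x - (x + h)) = kernel s h := by
            rw [← kernel_neg]
            simp
          rw [hk]
          congr 2
          ring
        · have h1 : (x, x + h) ∉ Ω ×ˢ Ω := hx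
          have h2 : x ∉ Ω ∩ (fun x => x + h) ⁻¹' Ω := hx
          simp [F, indicator_of_notMem h1, indicator_of_notMem h2]

/-- The reflection of the last variable. -/
def flipLast (h : Full d) : Full d := (h.1, -h.2)

lemma euclNorm_flipLast (h : Full d) : euclNorm (flipLast h) = euclNorm h := by
  simp [euclNorm, flipLast]

lemma measurePreserving_flipLast : MeasurePreserving (flipLast (d := d)) :=
  (MeasurePreserving.id volume).prod (Measure.measurePreserving_neg volume)

lemma lintegral_flipLast {f : Full d → ℝ≥0∞} (hf : Measurable f) :
    ∫⁻ h, f (flipLast h) = ∫⁻ h, f h :=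
  measurePreserving_flipLast.lintegral_comp hf

/-- A planar increment by `2h'` is the composition of the increments by `(h', h_d)` and
`(h', -h_d)`. -/
lemma setLIntegral_planar_increment_le {Ω A : Set (Full d)} {u : Full d → ℝ} (hu : Measurable u)
    {h : Full d} (h0 : A ⊆ Ω) (h1 : ∀ x ∈ A, x + h ∈ Ω)
    (h2 : ∀ x ∈ A, x + (2 • h.1, (0 : ℝ)) ∈ Ω) :
    ∫⁻ x in A, ENNReal.ofReal ((u (x + (2 • h.1, (0 : ℝ))) - u x) ^ 2) ≤
      2 * incrSq Ω u h + 2 * incrSq Ω u (flipLast h) := by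
  have hadd : ∀ x : Full d, x + (2 • h.1, (0 : ℝ)) = x + h + flipLast h := by
    intro x
    ext1
    · simp [flipLast, two_smul, add_assoc]
    · simp [flipLast]
  calc _ ≤ ∫⁻ x in A, (2 * ENNReal.ofReal ((u (x + h) - u x) ^ 2) +
        2 * ENNReal.ofReal ((u (x + h + flipLast h) - u (x + h)) ^ 2)) := by
        refine lintegral_mono fun x => ?_
        have hmul : ∀ a : ℝ, 2 * ENNReal.ofReal a = ENNReal.ofReal (2 * a) := fun a => by
          rw [ENNReal.ofReal_mul zero_le_two, ENNReal.ofReal_ofNat]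
        rw [hmul, hmul, ← ENNReal.ofReal_add (by positivity) (by positivity), hadd]
        refine ENNReal.ofReal_le_ofReal ?_
        nlinarith [sq_nonneg ((u (x + h) - u x) - (u (x + h + flipLast h) - u (x + h)))]
    _ = (2 * ∫⁻ x in A, ENNReal.ofReal ((u (x + h) - u x) ^ 2)) +
        2 * ∫⁻ x in A, ENNReal.ofReal ((u (x + h + flipLast h) - u (x + h)) ^ 2) := by
        rw [lintegral_add_left (by fun_prop), lintegral_const_mul _ (by fun_prop),
          lintegral_const_mul _ (by fun_prop)]
    _ ≤ _ := by
        gcongr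
        · exact lintegral_mono_set fun x hx => ⟨h0 hx, h1 x hx⟩
        -- The second step starts from x + h. Translation by h turns it into an increment based at a
        -- point of Ω, and the requirement that x + h + `flipLast h` lie in Ω is the hypothesis on
        -- the planar increment.
        · have hsub : A ⊆ (fun x => x + h) ⁻¹' (Ω ∩ (fun x => x + flipLast h) ⁻¹' Ω) :=
            fun x hx => ⟨h1 x hx, by simpa [hadd] using h2 x hx⟩
          refine (lintegral_mono_set hsub).trans (le_of_eq ?_)
          exact (measurePreserving_add_right volume h).setLIntegral_comp_preimage_emb
            (measurableEmbedding_addRight h) (fun x => ENNReal.ofReal ((u (x + flipLast h) - u x) ^ 2))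
            _

/-- Kernel and Lebesgue measure are invariant under the reflection, so both terms have the same
weighted integral. The total factor 4 is exactly the square of the length factor 2 of the planar
increment 2h', so nothing is lost in the limit. -/
lemma setLIntegral_kernel_mul_incrSq_add_flip_le {Ω : Set (Full d)} (hΩ : MeasurableSet Ω)
    {u : Full d → ℝ} (hu : Measurable u) (s R : ℝ) :
    ∫⁻ h in {h | euclNorm h < R},
        kernel s h * (2 * incrSq Ω u h + 2 * incrSq Ω u (flipLast h)) ≤
      4 * gagliardoSq s Ω u := by
  have hi := measurable_incrSq hΩ hu
  have hflip : Measurable (flipLast (d := d)) := measurePreserving_flipLast.measurable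
  have hk : ∀ h : Full d, kernel s h = kernel s (flipLast h) := by
    intro h
    rw [kernel, kernel, euclNorm_flipLast]
  refine (setLIntegral_le_lintegral _ _).trans (le_of_eq ?_)
  calc _ = ∫⁻ h, (2 * (kernel s h * incrSq Ω u h) +
        2 * (kernel s (flipLast h) * incrSq Ω u (flipLast h))) := by
        congr with h
        rw [← hk]
        ring
    _ = (2 * ∫⁻ h, kernel s h * incrSq Ω u h) +
        2 * ∫⁻ h, kernel s (flipLast h) * incrSq Ω u (flipLast h) := by
        rw [lintegral_add_left (by fun_prop), lintegral_const_mul _ (by fun_prop),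
          lintegral_const_mul _ (by fun_prop)]
    _ = _ := by
        rw [lintegral_flipLast (f := fun h => kernel s h * incrSq Ω u h) (by fun_prop),
          gagliardoSq_eq_lintegral_incrSq hΩ hu]
        ring

/-- Change of the last variable by dilation. -/
lemma setLIntegral_prod_dilation {ε : ℝ} (hε : 0 < ε) (T : Set (Planar d))
    (a b : ℝ) (f : Full d → ℝ≥0∞) :
    ∫⁻ x in T ×ˢ Icc (ε * a) (ε * b), f x =
      ENNReal.ofReal ε * ∫⁻ x in T ×ˢ Icc a b, f (x.1, ε * x.2) := by
  let e : Full d ≃ᵐ Full d :=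
    (MeasurableEquiv.refl (Planar d)).prodCongr (Homeomorph.mulLeft₀ ε hε.ne').toMeasurableEquiv
  have hmap : (volume : Measure (Full d)) = ENNReal.ofReal ε • Measure.map e volume := by
    have h1 : Measure.map e volume = (Measure.map id (volume : Measure (Planar d))).prod
        (Measure.map (ε * ·) (volume : Measure ℝ)) := by
      rw [Measure.map_prod_map _ _ measurable_id (measurable_const_mul ε)]
      rfl
    rw [h1, Measure.map_id, Real.map_volume_mul_left hε.ne', abs_of_pos (inv_pos.2 hε),
      Measure.prod_smul_right, smul_smul, ← ENNReal.ofReal_mul hε.le, mul_inv_cancel₀ hε.ne']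
    simp [Measure.volume_eq_prod]
  conv_lhs => rw [hmap, Measure.restrict_smul, lintegral_smul_measure,
    e.measurableEmbedding.restrict_map, lintegral_map_equiv]
  have hpre : e ⁻¹' (T ×ˢ Icc (ε * a) (ε * b)) = T ×ˢ Icc a b := by
    ext x
    have : e x = (x.1, ε * x.2) := rfl
    simp [this, hε]
  rw [hpre]
  rfl

end Gagliardo

/-! ### Uniform first-order expansions of compactly supported functions. -/

section UniformDifferentiability

variable {V W : Type*} [NormedAddCommGroup V] [NormedSpace ℝ V]
  [NormedAddCommGroup W] [NormedSpace ℝ W]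

/-- The derivative is uniformly continuous, being continuous with compact support; the mean value
inequality on a ball then gives a remainder uniform in x. -/
lemma exists_norm_sub_fderiv_le {f : V → W} (hf : ContDiff ℝ 1 f) (hc : HasCompactSupport f)
    {η : ℝ} (hη : 0 < η) :
    ∃ ρ > 0, ∀ x z, ‖z‖ ≤ ρ → ‖f (x + z) - f x - fderiv ℝ f x z‖ ≤ η * ‖z‖ := by
  have huc : UniformContinuous (fderiv ℝ f) :=
    (hc.fderiv ℝ).uniformContinuous_of_continuous (hf.continuous_fderiv one_ne_zero)
  obtain ⟨ρ, hρ, h⟩ := Metric.uniformContinuous_iff.1 huc η hη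
  refine ⟨ρ / 2, by positivity, fun x z hz => ?_⟩
  have := (convex_ball x ρ).norm_image_sub_le_of_norm_fderiv_le' (𝕜 := ℝ) (f := f)
    (φ := fderiv ℝ f x) (C := η) (x := x) (y := x + z)
    (fun w _ => hf.differentiable one_ne_zero w)
    (fun w hw => by
      rw [← dist_eq_norm]
      exact (h hw).le)
    (Metric.mem_ball_self hρ) (by rw [Metric.mem_ball]; simp; linarith)
  simpa using this

lemma exists_norm_sub_le_mul {f : V → W} (hf : ContDiff ℝ 1 f) (hc : HasCompactSupport f) :
    ∃ M : ℝ, 0 ≤ M ∧ ∀ x z, ‖f (x + z) - f x‖ ≤ M * ‖z‖ := by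
  obtain ⟨C, hC⟩ := hf.lipschitzWith_of_hasCompactSupport hc one_ne_zero
  refine ⟨C, C.2, fun x z => ?_⟩
  simpa using hC.norm_sub_le (x + z) x

end UniformDifferentiability

/-! ### Lower bound for planar increments by duality. -/

section PlanarIncrement

variable {d : ℕ}

/-- A quantitative form of the lower semicontinuity of the increments: the vector field `Ψ` is used
to test the increment `U(x' + 2y, x_d) - U(x)`, and `u` is close to `U`. -/
lemma le_integral_planar_increment {U : Full d → ℝ} (hU : MemLp U 2 volume) (hU1 : Integrable U)
    {u : Planar d → ℝ} (hu : Integrable u) {G : Planar d → Planar d} (hG : MemLp G 2 volume)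
    {Ψ : Planar d → Planar d} (hΨ : ContDiff ℝ (⊤ : ℕ∞) Ψ) (hc : HasCompactSupport Ψ)
    {y : Planar d}
    (hweak : ∫ x, u x * inner ℝ (fderiv ℝ Ψ x y) y = - ∫ x, inner ℝ (G x) y * inner ℝ (Ψ x) y)
    {a b : ℝ} (hab : a ≤ b) {M η : ℝ}
    (hM : ∀ x z, ‖Ψ (x + z) - Ψ x‖ ≤ M * ‖z‖)
    (hη : ∀ x, ‖Ψ (x + -((2 : ℝ) • y)) - Ψ x - fderiv ℝ Ψ x (-((2 : ℝ) • y))‖ ≤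
      η * ‖-((2 : ℝ) • y)‖)
    {K : Set (Planar d)} (hKm : MeasurableSet K)
    (hK : ∀ x ∉ K, Ψ (x + -((2 : ℝ) • y)) = 0 ∧ Ψ x = 0) :
    (b - a) * (4 * ∫ x, inner ℝ (G x) y ^ 2) - (b - a) * (4 * ‖y‖ ^ 2 * ∫ x, ‖G x - Ψ x‖ ^ 2)
      - 8 * M * ‖y‖ ^ 2 * (∫ x in K ×ˢ Icc a b, |U x - u x.1|)
      - (b - a) * (8 * η * ‖y‖ ^ 2 * ∫ x, |u x|) ≤
    ∫ x in tsupport Ψ ×ˢ Icc a b, (U (x + ((2 : ℝ) • y, (0 : ℝ))) - U x) ^ 2 := by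
  have hΨcont : Continuous Ψ := hΨ.continuous
  have hΨ2 : MemLp Ψ 2 volume := hΨcont.memLp_of_hasCompactSupport hc
  -- The slab is full in the planar directions, so its measure is invariant under planar
  -- translations; this is what makes the discrete integration by parts below free of boundary
  -- terms.
  set ν : Measure ℝ := volume.restrict (Icc a b) with hν
  set μ : Measure (Full d) := (volume : Measure (Planar d)).prod ν with hμ
  have hrestr : ∀ S : Set (Planar d), volume.restrict (S ×ˢ Icc a b) = μ.restrict (S ×ˢ univ) := by
    intro S
    rw [hμ, hν, ← Measure.prod_restrict, Measure.volume_eq_prod, ← Measure.prod_restrict,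
      Measure.restrict_univ]
  have hμle : μ ≤ volume := by
    have := hrestr univ
    rw [univ_prod_univ, Measure.restrict_univ] at this
    rw [← this]
    exact Measure.restrict_le_self
  have hUμ : MemLp U 2 μ := hU.mono_measure hμle
  have hUμ1 : Integrable U μ := hU1.mono_measure hμle
  let τ : Full d → Full d := fun x => x + ((2 : ℝ) • y, (0 : ℝ))
  have hτ : MeasurePreserving τ μ μ := by
    have := (measurePreserving_add_right (volume : Measure (Planar d)) ((2 : ℝ) • y)).prod
      (MeasurePreserving.id ν)
    convert! this using 1
    ext x <;> simp [τ]
  have hτe : MeasurableEmbedding τ := measurableEmbedding_addRight _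
  -- The test function is the expected value of the increment: along 2y the function should change
  -- by about 2⟨∇'u, y⟩, and Ψ stands for ∇'u.
  set φ : Planar d → ℝ := fun x => 2 * inner ℝ (Ψ x) y with hφ
  have hφcont : Continuous φ := by fun_prop
  have hφc : HasCompactSupport φ := by
    refine hc.mono fun x hx => ?_
    simp only [φ, Function.mem_support] at hx ⊢
    contrapose! hx
    simp [hx]
  have hφ2 : MemLp φ 2 volume := hφcont.memLp_of_hasCompactSupport hφc
  obtain ⟨B, hB⟩ := hφc.exists_bound_of_continuous hφcont
  set δφ : Planar d → ℝ := fun x => φ (x + -((2 : ℝ) • y)) - φ x with hδφ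
  have hδφcont : Continuous δφ := by fun_prop
  have hδφB : ∀ x, ‖δφ x‖ ≤ 4 * M * ‖y‖ ^ 2 := by
    intro x
    have h1 : δφ x = 2 * inner ℝ (Ψ (x + -((2 : ℝ) • y)) - Ψ x) y := by
      simp only [δφ, φ, inner_sub_left]
      ring
    rw [h1, norm_mul, Real.norm_ofNat]
    have h2 := norm_inner_le_norm (𝕜 := ℝ) (Ψ (x + -((2 : ℝ) • y)) - Ψ x) y
    have h3 := hM x (-((2 : ℝ) • y))
    rw [norm_neg, norm_smul, Real.norm_ofNat] at h3
    nlinarith [norm_nonneg y]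
  -- the increments are square integrable
  have hUτ2 : MemLp (fun x => U (τ x)) 2 μ := hUμ.comp_measurePreserving hτ
  have hUτ1 : Integrable (fun x => U (τ x)) μ := hτ.integrable_comp_of_integrable hUμ1
  have hΔ2 : MemLp (fun x => U (τ x) - U x) 2 μ := hUτ2.sub hUμ
  have hΔ1 : Integrable (fun x => U (τ x) - U x) μ := hUτ1.sub hUμ1
  have mulφ : ∀ {f : Full d → ℝ}, Integrable f μ → ∀ {g : Planar d → ℝ} {B : ℝ}, Continuous g →
      (∀ x, ‖g x‖ ≤ B) → Integrable (fun x => f x * g x.1) μ := by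
    intro f hf g B hg hgB
    exact hf.mul_bdd (by fun_prop) (.of_forall fun x => hgB x.1)
  have hφsq : Integrable (fun x : Full d => φ x.1 ^ 2) μ :=
    (hφ2.integrable_sq).comp_fst ν
  -- testing
  have s1 : 2 * ∫ x, (U (τ x) - U x) * φ x.1 ∂μ - ∫ x : Full d, φ x.1 ^ 2 ∂μ ≤
      ∫ x in tsupport Ψ ×ˢ Icc a b, (U (τ x) - U x) ^ 2 := by
    rw [hrestr, ← integral_const_mul, ← integral_sub ((mulφ hΔ1 hφcont hB).const_mul 2) hφsq,
      ← setIntegral_eq_integral_of_forall_compl_eq_zero (s := tsupport Ψ ×ˢ univ)]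
    · refine integral_mono ?_ hΔ2.integrable_sq.integrableOn fun x => ?_
      · exact (((mulφ hΔ1 hφcont hB).const_mul 2).sub hφsq).integrableOn
      -- With Δ the increment, 2Δφ - φ² ≤ Δ².
      · nlinarith [sq_nonneg (U (τ x) - U x - φ x.1)]
    · intro x hx
      have : Ψ x.1 = 0 := image_eq_zero_of_notMem_tsupport fun h => hx ⟨h, mem_univ _⟩
      simp [φ, this]
  -- Summation by parts: the translation passes to the smooth function φ, whose difference is of
  -- order |y|².
  have s2 : ∫ x, (U (τ x) - U x) * φ x.1 ∂μ = ∫ x, U x * δφ x.1 ∂μ := by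
    have hsh : ∫ x, U (τ x) * φ x.1 ∂μ = ∫ x, U x * φ (x.1 + -((2 : ℝ) • y)) ∂μ := by
      rw [← hτ.integral_comp hτe (fun x => U x * φ (x.1 + -((2 : ℝ) • y)))]
      simp [τ]
    simp only [sub_mul, δφ, mul_sub]
    rw [integral_sub (mulφ hUτ1 hφcont hB) (mulφ hUμ1 hφcont hB), hsh, integral_sub
      (mulφ hUμ1 (g := fun x => φ (x + -((2 : ℝ) • y))) (by fun_prop) (fun x => hB _))
      (mulφ hUμ1 hφcont hB)]
  have hu' : Integrable (fun x : Full d => u x.1) μ := hu.comp_fst ν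
  have hνr : ν.real univ = b - a := by simp [ν, hab]
  -- Replacing U by u costs its L¹ distance to u over K, where δφ is supported, times the bound
  -- 4M|y|² of δφ. Without the second factor |y| this could not be integrated against the kernel.
  have s3 : (b - a) * (∫ x, u x * δφ x) - 4 * M * ‖y‖ ^ 2 * (∫ x in K ×ˢ Icc a b, |U x - u x.1|) ≤
      ∫ x, U x * δφ x.1 ∂μ := by
    have hUu : Integrable (fun x : Full d => U x - u x.1) μ := hUμ1.sub hu'
    have h1 : ∫ x, U x * δφ x.1 ∂μ =
        ∫ x : Full d, u x.1 * δφ x.1 ∂μ + ∫ x, (U x - u x.1) * δφ x.1 ∂μ := by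
      rw [← integral_add (mulφ hu' hδφcont hδφB) (mulφ hUu hδφcont hδφB)]
      congr with x
      ring
    have h2 : ∫ x : Full d, u x.1 * δφ x.1 ∂μ = (b - a) * ∫ x, u x * δφ x := by
      have := integral_fun_fst (μ := (volume : Measure (Planar d))) (ν := ν)
        (fun x => u x * δφ x)
      rw [hνr] at this
      exact this
    have h3 : -(4 * M * ‖y‖ ^ 2 * (∫ x in K ×ˢ Icc a b, |U x - u x.1|)) ≤
        ∫ x, (U x - u x.1) * δφ x.1 ∂μ := by
      rw [hrestr, ← integral_indicator (hKm.prod .univ), ← integral_const_mul, ← integral_neg]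
      refine integral_mono ?_ (mulφ hUu hδφcont hδφB) fun x => ?_
      · exact ((hUu.abs.indicator (hKm.prod .univ)).const_mul _).neg
      · by_cases hx : x.1 ∈ K
        · have hx' : x ∈ K ×ˢ (univ : Set ℝ) := ⟨hx, mem_univ _⟩
          simp only [indicator_of_mem hx']
          have h4 := neg_abs_le ((U x - u x.1) * δφ x.1)
          rw [abs_mul] at h4
          have h5 := hδφB x.1
          rw [Real.norm_eq_abs] at h5
          nlinarith [abs_nonneg (U x - u x.1)]
        · have hx' : x ∉ K ×ˢ (univ : Set ℝ) := fun h => hx h.1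
          have h4 := hK x.1 hx
          simp [indicator_of_notMem hx', δφ, φ, h4.1, h4.2]
    linarith
  have hD : Continuous fun x => inner ℝ (fderiv ℝ Ψ x y) y := by
    have := hΨ.continuous_fderiv (by simp)
    fun_prop
  obtain ⟨B', hB'⟩ : ∃ B', ∀ x, ‖inner ℝ (fderiv ℝ Ψ x y) y‖ ≤ B' := by
    refine HasCompactSupport.exists_bound_of_continuous ((hc.fderiv ℝ).mono fun x hx => ?_) hD
    simp only [Function.mem_support] at hx ⊢
    contrapose! hx
    simp [hx]
  -- First-order expansion of δφ: it differs from -4⟨DΨ(y), y⟩ by at most 4η|y|².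
  have s4 : -4 * (∫ x, u x * inner ℝ (fderiv ℝ Ψ x y) y) - 4 * η * ‖y‖ ^ 2 * (∫ x, |u x|) ≤
      ∫ x, u x * δφ x := by
    rw [← integral_const_mul, ← integral_const_mul, ← integral_sub
      ((hu.mul_bdd (by fun_prop) (.of_forall hB')).const_mul _) (hu.abs.const_mul _)]
    refine integral_mono (((hu.mul_bdd (by fun_prop) (.of_forall hB')).const_mul _).sub
      (hu.abs.const_mul _)) (hu.mul_bdd (by fun_prop) (.of_forall hδφB)) fun x => ?_
    have h1 : δφ x + 4 * inner ℝ (fderiv ℝ Ψ x y) y = 2 * inner ℝ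
        (Ψ (x + -((2 : ℝ) • y)) - Ψ x - fderiv ℝ Ψ x (-((2 : ℝ) • y))) y := by
      simp only [δφ, φ, inner_sub_left, map_neg, map_smul, inner_neg_left, inner_smul_left]
      simp
      ring
    have h2 : |δφ x + 4 * inner ℝ (fderiv ℝ Ψ x y) y| ≤ 4 * η * ‖y‖ ^ 2 := by
      rw [h1, abs_mul, abs_two]
      have h2 := abs_real_inner_le_norm
        (Ψ (x + -((2 : ℝ) • y)) - Ψ x - fderiv ℝ Ψ x (-((2 : ℝ) • y))) y
      have h3 := hη x
      rw [norm_neg, norm_smul, Real.norm_ofNat] at h3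
      nlinarith [norm_nonneg y]
    have h3 := neg_abs_le (u x * (δφ x + 4 * inner ℝ (fderiv ℝ Ψ x y) y))
    rw [abs_mul] at h3
    simp only
    nlinarith [abs_nonneg (u x)]
  have s5 : ∫ x : Full d, φ x.1 ^ 2 ∂μ = (b - a) * (4 * ∫ x, inner ℝ (Ψ x) y ^ 2) := by
    have := integral_fun_fst (μ := (volume : Measure (Planar d))) (ν := ν) (fun x => φ x ^ 2)
    rw [hνr] at this
    have h4 : ∀ x, φ x ^ 2 = 4 * inner ℝ (Ψ x) y ^ 2 := fun x => by
      simp only [φ]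
      ring
    rw [this, smul_eq_mul]
    simp only [h4]
    rw [integral_const_mul]
  have hGy : MemLp (fun x => inner ℝ (G x) y) 2 volume := hG.inner_const y
  have hΨy : MemLp (fun x => inner ℝ (Ψ x) y) 2 volume := hΨ2.inner_const y
  -- With a = ⟨G, y⟩ and b = ⟨Ψ, y⟩, one has 8ab - 4b² = 4a² - 4(a - b)², and (a - b)² ≤ |y|² |G -
  -- Ψ|².
  have s6 : 4 * (∫ x, inner ℝ (G x) y ^ 2) - 4 * ‖y‖ ^ 2 * (∫ x, ‖G x - Ψ x‖ ^ 2) ≤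
      8 * (∫ x, inner ℝ (G x) y * inner ℝ (Ψ x) y) - 4 * ∫ x, inner ℝ (Ψ x) y ^ 2 := by
    have hi : Integrable fun x => inner ℝ (G x) y * inner ℝ (Ψ x) y := hGy.integrable_mul hΨy
    have hn : Integrable fun x => ‖G x - Ψ x‖ ^ 2 := (hG.sub hΨ2).integrable_norm_pow (by norm_num)
    simp only [← integral_const_mul]
    rw [← integral_sub (hGy.integrable_sq.const_mul _) (hn.const_mul _),
      ← integral_sub (hi.const_mul _) (hΨy.integrable_sq.const_mul _)]
    refine integral_mono ((hGy.integrable_sq.const_mul _).sub (hn.const_mul _))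
      ((hi.const_mul _).sub (hΨy.integrable_sq.const_mul _)) fun x => ?_
    have h1 := abs_real_inner_le_norm (G x - Ψ x) y
    have h2 : inner ℝ (G x - Ψ x) y ^ 2 ≤ (‖G x - Ψ x‖ * ‖y‖) ^ 2 := sq_le_sq' (by
      linarith [neg_abs_le (inner ℝ (G x - Ψ x) y)]) ((le_abs_self _).trans h1)
    rw [inner_sub_left] at h2
    simp only
    nlinarith
  rw [hweak] at s4
  have hba : 0 ≤ b - a := sub_nonneg.2 hab
  have s7 := mul_le_mul_of_nonneg_left s4 hba
  have s8 := mul_le_mul_of_nonneg_left s6 hba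
  rw [s2, s5] at s1
  change _ ≤ ∫ x in tsupport Ψ ×ˢ Icc a b, (U (τ x) - U x) ^ 2
  linarith

end PlanarIncrement

/-! ### The weak gradient and the lower bound at a fixed thickness. -/

section

variable {d : ℕ}

/-- The weak gradient of the extension by zero, tested with functions supported in `ω`. -/
lemma IsH1WithGradient.integral_indicator_eq {ω : Set (Planar d)} (hω : MeasurableSet ω)
    {u : Planar d → ℝ} {G : Planar d → Planar d} (hu : IsH1WithGradient ω u G)
    {φ : Planar d → ℝ} (hφ : ContDiff ℝ (⊤ : ℕ∞) φ) (hc : HasCompactSupport φ)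
    (hs : tsupport φ ⊆ ω) (v : Planar d) :
    ∫ x, ω.indicator u x * fderiv ℝ φ x v = - ∫ x, inner ℝ (ω.indicator G x) v * φ x := by
  have h := hu.integral_eq φ hφ hc hs v
  rw [← integral_indicator hω, ← integral_indicator hω] at h
  have e1 : ∀ x, ω.indicator u x * fderiv ℝ φ x v = ω.indicator (fun x => u x * fderiv ℝ φ x v) x :=
    fun x => by by_cases hx : x ∈ ω <;> simp [hx]
  have e2 : ∀ x, inner ℝ (ω.indicator G x) v * φ x = ω.indicator (fun x => inner ℝ (G x) v * φ x) x :=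
    fun x => by by_cases hx : x ∈ ω <;> simp [hx]
  simp_rw [e1, e2, h]

/-- The scalar weak formulation is applied to the component ⟨Ψ, y⟩, differentiated in the same
direction y. -/
lemma integral_mul_inner_fderiv {ω : Set (Planar d)} {u : Planar d → ℝ} {G : Planar d → Planar d}
    (hw : ∀ φ : Planar d → ℝ, ContDiff ℝ (⊤ : ℕ∞) φ → HasCompactSupport φ → tsupport φ ⊆ ω →
      ∀ v, ∫ x, u x * fderiv ℝ φ x v = - ∫ x, inner ℝ (G x) v * φ x)
    {Ψ : Planar d → Planar d} (hΨ : ContDiff ℝ (⊤ : ℕ∞) Ψ) (hc : HasCompactSupport Ψ)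
    (hs : tsupport Ψ ⊆ ω) (y : Planar d) :
    ∫ x, u x * inner ℝ (fderiv ℝ Ψ x y) y = - ∫ x, inner ℝ (G x) y * inner ℝ (Ψ x) y := by
  have hsub : Function.support (fun x => inner ℝ (Ψ x) y) ⊆ Function.support Ψ := by
    intro x hx
    simp only [Function.mem_support] at hx ⊢
    contrapose! hx
    simp [hx]
  rw [← hw (fun x => inner ℝ (Ψ x) y) (hΨ.inner ℝ contDiff_const) (hc.mono hsub)
    ((closure_mono hsub).trans hs) y]
  congr with x
  rw [fderiv_inner_apply ℝ (hΨ.differentiable (by simp) x) (differentiableAt_const y)]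
  simp

/-- Integrating squared planar components of a field against the kernel on a small ball. -/
lemma setLIntegral_kernel_mul_lintegral_inner_sq (hd : 1 ≤ d) {μ : Measure (Planar d)} [SFinite μ]
    {G : Planar d → Planar d} (hG : AEStronglyMeasurable G μ) {s R : ℝ} (hs : s < 1) (hR : 0 < R) :
    ∫⁻ h : Full d in {h | euclNorm h < R},
        kernel s h * ∫⁻ x, ENNReal.ofReal (inner ℝ (G x) h.1 ^ 2) ∂μ =
      ENNReal.ofReal (sphereArea d / d * (R ^ (2 - 2 * s) / (2 - 2 * s))) *
        ∫⁻ x, ENNReal.ofReal (‖G x‖ ^ 2) ∂μ := by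
  have hGm : AEMeasurable G μ := hG.aemeasurable
  have hm : AEMeasurable (fun p : Full d × Planar d =>
      kernel s p.1 * ENNReal.ofReal (inner ℝ (G p.2) p.1.1 ^ 2))
      ((volume.restrict {h | euclNorm h < R}).prod μ) := by
    have : AEMeasurable (fun p : Full d × Planar d => G p.2)
      ((volume.restrict {h | euclNorm h < R}).prod μ) := hGm.comp_snd
    have h2 : AEMeasurable (fun p : Full d × Planar d => inner ℝ (G p.2) p.1.1)
      ((volume.restrict {h | euclNorm h < R}).prod μ) := this.inner (by fun_prop)
    have h3 : Measurable (fun p : Full d × Planar d => kernel s p.1) := by fun_prop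
    exact h3.aemeasurable.mul (h2.pow_const 2).ennreal_ofReal
  calc _ = ∫⁻ h : Full d in {h | euclNorm h < R},
        ∫⁻ x, kernel s h * ENNReal.ofReal (inner ℝ (G x) h.1 ^ 2) ∂μ := by
        refine lintegral_congr fun h => ?_
        rw [lintegral_const_mul'']
        exact ((hGm.inner aemeasurable_const).pow_const 2).ennreal_ofReal
    _ = ∫⁻ x, (∫⁻ h : Full d in {h | euclNorm h < R},
        kernel s h * ENNReal.ofReal (inner ℝ (G x) h.1 ^ 2)) ∂μ := lintegral_lintegral_swap hm
    _ = _ := by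
        simp_rw [← ofReal_div_euclNorm, setLIntegral_inner_sq_div hd _ hs hR]
        rw [lintegral_const_mul'']
        exact (hGm.norm.pow_const 2).ennreal_ofReal

/-- A lower bound of the energy of a film of thickness `ε`. -/
lemma le_mul_gagliardoSq (hd : 1 ≤ d) {ω : Set (Planar d)} (hω : MeasurableSet ω)
    {U : Full d → ℝ} (hUm : Measurable U) (hU : MemLp U 2 volume) (hU1 : Integrable U)
    {u : Planar d → ℝ} (hu : Integrable u) {G : Planar d → Planar d} (hG : MemLp G 2 volume)
    {Ψ : Planar d → Planar d} (hΨ : ContDiff ℝ (⊤ : ℕ∞) Ψ) (hc : HasCompactSupport Ψ)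
    (hweak : ∀ y, ∫ x, u x * inner ℝ (fderiv ℝ Ψ x y) y =
      - ∫ x, inner ℝ (G x) y * inner ℝ (Ψ x) y)
    {s ε δ : ℝ} (hs : s < 1) (hε : 0 < ε) (hδ : 0 < δ) (hδ2 : δ < 1 / 2) {M η κ : ℝ}
    (hM0 : 0 ≤ M) (hη0 : 0 ≤ η) (hM : ∀ x z, ‖Ψ (x + z) - Ψ x‖ ≤ M * ‖z‖)
    (hη : ∀ x z, ‖z‖ ≤ 2 * (δ * ε) → ‖Ψ (x + z) - Ψ x - fderiv ℝ Ψ x z‖ ≤ η * ‖z‖)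
    {K : Set (Planar d)} (hKm : MeasurableSet K)
    (hK : ∀ x ∈ tsupport Ψ, ∀ z, ‖z‖ ≤ 2 * (δ * ε) → x + z ∈ K) (hKω : K ⊆ ω)
    (hclose : ∫ x in K ×ˢ Icc (ε * δ) (ε * (1 - δ)), |U x - u x.1| ≤ ε * κ)
    {C : ℝ} (hC0 : 0 ≤ C)
    (hC : 4 * (∫ x, ‖G x - Ψ x‖ ^ 2) + 8 * M * κ + 8 * η * ∫ x, |u x| ≤ C) :
    ENNReal.ofReal ((1 - 2 * δ) * δ ^ (2 - 2 * s) * (sphereArea d / (2 * d))) *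
        ∫⁻ x, ENNReal.ofReal (‖G x‖ ^ 2) ≤
      ENNReal.ofReal ((1 - s) / ε ^ (3 - 2 * s)) * gagliardoSq s (film ω ε) U +
        ENNReal.ofReal (C * sphereArea d * δ ^ (2 - 2 * s) / 8) := by
  have hΩ : MeasurableSet (film ω ε) := hω.prod measurableSet_Ioo
  have hΨ2 : MemLp Ψ 2 volume := hΨ.continuous.memLp_of_hasCompactSupport hc
  set R := δ * ε with hR
  have hRpos : 0 < R := by positivity
  set N := ∫⁻ x, ENNReal.ofReal (‖G x‖ ^ 2) with hN
  -- the pointwise estimate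
  have hpt : ∀ h : Full d, euclNorm h < R →
      ENNReal.ofReal (4 * ε * (1 - 2 * δ)) * ∫⁻ x, ENNReal.ofReal (inner ℝ (G x) h.1 ^ 2) ≤
      (2 * incrSq (film ω ε) U h + 2 * incrSq (film ω ε) U (flipLast h)) +
        ENNReal.ofReal (ε * C) * ENNReal.ofReal (‖h.1‖ ^ 2) := by
    intro h hh
    have hy : ‖h.1‖ < R := (norm_fst_le_euclNorm h).trans_lt hh
    have hz : |h.2| < R := (abs_snd_le_euclNorm h).trans_lt hh
    have h2y : ‖-((2 : ℝ) • h.1)‖ ≤ 2 * R := by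
      rw [norm_neg, norm_smul, Real.norm_ofNat]
      linarith
    have hTK : tsupport Ψ ⊆ K := fun x hx => by simpa using hK x hx 0 (by simp; positivity)
    have hKΨ : ∀ x ∉ K, Ψ (x + -((2 : ℝ) • h.1)) = 0 ∧ Ψ x = 0 := by
      refine fun x hx => ⟨?_, image_eq_zero_of_notMem_tsupport fun h => hx (hTK h)⟩
      refine image_eq_zero_of_notMem_tsupport fun hx' => hx ?_
      simpa using hK _ hx' ((2 : ℝ) • h.1) (by rwa [norm_neg] at h2y)
    have key := le_integral_planar_increment hU hU1 hu hG hΨ hc (hweak h.1)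
      (a := ε * δ) (b := ε * (1 - δ)) (by nlinarith) hM (fun x => hη x _ h2y) hKm hKΨ
    -- Heights in the core stay at distance δε from both faces and R = δε, so a vertical move
    -- shorter than R remains in the film; K absorbs planar moves up to 2R.
    have hA : ∀ x ∈ tsupport Ψ ×ˢ Icc (ε * δ) (ε * (1 - δ)), ∀ k : Full d, ‖k.1‖ ≤ 2 * R →
        |k.2| < R → x + k ∈ film ω ε := by
      rintro x ⟨hx1, hx2⟩ k hk1 hk2
      have := abs_lt.1 hk2
      refine ⟨hKω (hK _ hx1 _ hk1), ?_, ?_⟩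
      · have := hx2.1
        simp only [Prod.snd_add]
        nlinarith
      · have := hx2.2
        simp only [Prod.snd_add]
        nlinarith
    have htwo := setLIntegral_planar_increment_le (Ω := film ω ε)
      (A := tsupport Ψ ×ˢ Icc (ε * δ) (ε * (1 - δ))) (h := h) hUm
      (fun x hx => by simpa using hA x hx 0 (by simp; positivity) (by simpa using hRpos))
      (fun x hx => hA x hx h (by linarith) hz)
      (fun x hx => hA x hx _ (by
        simp only
        rw [two_smul, ← two_smul ℝ, ← norm_neg]
        exact h2y) (by simpa using hRpos))
    have hint : IntegrableOn (fun x => (U (x + ((2 : ℝ) • h.1, (0 : ℝ))) - U x) ^ 2)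
        (tsupport Ψ ×ˢ Icc (ε * δ) (ε * (1 - δ))) := by
      have := (hU.comp_measurePreserving
        (measurePreserving_add_right volume ((2 : ℝ) • h.1, (0 : ℝ)))).sub hU
      exact this.integrable_sq.integrableOn
    have h2 : ((2 : ℕ) • h.1, (0 : ℝ)) = ((2 : ℝ) • h.1, (0 : ℝ)) := by
      rw [two_smul, two_smul]
    rw [h2, ← ofReal_integral_eq_lintegral_ofReal hint (.of_forall fun x => sq_nonneg _)] at htwo
    rw [← ofReal_integral_eq_lintegral_ofReal (hG.inner_const h.1).integrable_sq
      (.of_forall fun x => sq_nonneg _), ← ENNReal.ofReal_mul (by nlinarith),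
      ← ENNReal.ofReal_mul (by positivity)]
    refine le_trans ?_ (add_le_add_left htwo _)
    rw [← ENNReal.ofReal_add (integral_nonneg fun x => sq_nonneg _) (by positivity)]
    apply ENNReal.ofReal_le_ofReal
    have e1 : 8 * M * ‖h.1‖ ^ 2 * (∫ x in K ×ˢ Icc (ε * δ) (ε * (1 - δ)), |U x - u x.1|) ≤
        8 * M * ‖h.1‖ ^ 2 * (ε * κ) := by gcongr
    have e2 : ε * ‖h.1‖ ^ 2 * (4 * (∫ x, ‖G x - Ψ x‖ ^ 2) + 8 * M * κ + 8 * η * ∫ x, |u x|) ≤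
        ε * ‖h.1‖ ^ 2 * C := by gcongr
    have hI0 : 0 ≤ ∫ x, ‖G x - Ψ x‖ ^ 2 := integral_nonneg fun x => by positivity
    -- The errors carry the slab height ε(1-2δ) ≤ ε. This bound and the similar one below allow the
    -- missing 2δ part to be dropped.
    have e3 : 0 ≤ δ * ε * ‖h.1‖ ^ 2 * (∫ x, ‖G x - Ψ x‖ ^ 2) := by positivity
    have hI1 : 0 ≤ ∫ x, |u x| := integral_nonneg fun x => abs_nonneg _
    have e4 : 0 ≤ δ * ε * ‖h.1‖ ^ 2 * (η * ∫ x, |u x|) := by positivity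
    nlinarith
  have hi := measurable_incrSq hΩ hUm
  have hflip : Measurable (flipLast (d := d)) := measurePreserving_flipLast.measurable
  -- integration against the kernel
  have hint : ENNReal.ofReal (4 * ε * (1 - 2 * δ)) *
      (ENNReal.ofReal (sphereArea d / d * (R ^ (2 - 2 * s) / (2 - 2 * s))) * N) ≤
      4 * gagliardoSq s (film ω ε) U +
        ENNReal.ofReal (ε * C) * ENNReal.ofReal (sphereArea d * (R ^ (2 - 2 * s) / (2 - 2 * s))) := by
    rw [hN, ← setLIntegral_kernel_mul_lintegral_inner_sq hd hG.aestronglyMeasurable hs hRpos,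
      ← lintegral_const_mul' _ _ ENNReal.ofReal_ne_top]
    calc _ ≤ ∫⁻ h : Full d in {h | euclNorm h < R},
          (kernel s h * (2 * incrSq (film ω ε) U h + 2 * incrSq (film ω ε) U (flipLast h)) +
          ENNReal.ofReal (ε * C) * (kernel s h * ENNReal.ofReal (‖h.1‖ ^ 2))) := by
          refine setLIntegral_mono' (measurableSet_lt (by fun_prop) measurable_const)
            fun h hh => ?_
          have := mul_le_mul_right (hpt h hh) (kernel s h)
          calc _ = _ := mul_left_comm _ _ _
            _ ≤ _ := this
            _ = _ := by ring
      _ = (∫⁻ h : Full d in {h | euclNorm h < R},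
          kernel s h * (2 * incrSq (film ω ε) U h + 2 * incrSq (film ω ε) U (flipLast h))) +
          ENNReal.ofReal (ε * C) * ∫⁻ h : Full d in {h | euclNorm h < R},
            kernel s h * ENNReal.ofReal (‖h.1‖ ^ 2) := by
          rw [lintegral_add_left (by fun_prop), lintegral_const_mul' _ _ ENNReal.ofReal_ne_top]
      _ ≤ _ := by
          gcongr
          · exact setLIntegral_kernel_mul_incrSq_add_flip_le hΩ hUm s R
          · simp_rw [← ofReal_div_euclNorm]
            exact setLIntegral_norm_sq_div_le hd hs hRpos
  have hp : 0 ≤ (1 - s) / ε ^ (3 - 2 * s) := div_nonneg (by linarith) (Real.rpow_nonneg hε.le _)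
  have h4 : (4 : ℝ≥0∞) = ENNReal.ofReal 4 := by simp
  -- Dividing by 4 cancels the factors from the doubled step and from the two increments. Since ε
  -- ε^{2-2s} = ε^{3-2s}, only δ^{2-2s} remains of the radius.
  have hmul := mul_le_mul_right hint (ENNReal.ofReal ((1 - s) / ε ^ (3 - 2 * s) / 4))
  have hσ := @sphereArea_nonneg d
  have h22 : 0 < 2 - 2 * s := by linarith
  have hRs : R ^ (2 - 2 * s) = δ ^ (2 - 2 * s) * ε ^ (2 - 2 * s) := Real.mul_rpow hδ.le hε.le
  have hεs : ε ^ (3 - 2 * s) = ε * ε ^ (2 - 2 * s) := by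
    rw [show 3 - 2 * s = 1 + (2 - 2 * s) by ring, Real.rpow_add hε, Real.rpow_one]
  have hεp : 0 < ε ^ (2 - 2 * s) := Real.rpow_pos_of_pos hε _
  have hd0 : (0 : ℝ) < d := by exact_mod_cast hd
  have h1s : 1 - s ≠ 0 := by linarith
  convert hmul using 1
  · rw [← mul_assoc, ← mul_assoc, ← ENNReal.ofReal_mul (by positivity),
      ← ENNReal.ofReal_mul (by
        have : 0 ≤ 1 - 2 * δ := by linarith
        positivity)]
    congr 2
    rw [hRs, hεs, show 2 - 2 * s = 2 * (1 - s) by ring]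
    field_simp
  · rw [mul_add, ← mul_assoc, h4, ← ENNReal.ofReal_mul (by positivity),
      ← ENNReal.ofReal_mul (by positivity), ← ENNReal.ofReal_mul (by positivity)]
    congr 3
    · ring
    · rw [hRs, hεs, show 2 - 2 * s = 2 * (1 - s) by ring]
      field_simp
      ring

end

/-! ### Density of test fields and the liminf inequality. -/

section

variable {d : ℕ}

lemma lintegral_enorm_sq_eq {α F : Type*} [MeasurableSpace α] {μ : Measure α}
    [NormedAddCommGroup F] (f : α → F) : ∫⁻ x, ‖f x‖ₑ ^ 2 ∂μ = eLpNorm f 2 μ ^ 2 := by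
  simpa using (eLpNorm_nnreal_pow_eq_lintegral (f := f) (μ := μ) (p := 2) two_ne_zero).symm

lemma integral_norm_sq_le_of_eLpNorm_le {α F : Type*} [MeasurableSpace α] {μ : Measure α}
    [NormedAddCommGroup F] {f : α → F} (hf : MemLp f 2 μ) {e : ℝ} (he : 0 ≤ e)
    (h : eLpNorm f 2 μ ≤ ENNReal.ofReal e) : ∫ x, ‖f x‖ ^ 2 ∂μ ≤ e ^ 2 := by
  rw [← ENNReal.ofReal_le_ofReal_iff (sq_nonneg e), ofReal_integral_eq_lintegral_ofReal
    (hf.integrable_norm_pow (by norm_num)) (.of_forall fun x => by positivity)]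
  calc ∫⁻ x, ENNReal.ofReal (‖f x‖ ^ 2) ∂μ = eLpNorm f 2 μ ^ 2 := by
        rw [← lintegral_enorm_sq_eq]
        congr with x
        simp [ENNReal.ofReal_pow]
    _ ≤ ENNReal.ofReal e ^ 2 := by gcongr
    _ = _ := by rw [ENNReal.ofReal_pow he]

/-- Smooth fields with compact support in `ω` are dense in `L²(ω)`. -/
lemma exists_contDiff_tsupport_subset_integral_sub_sq_le {ω : Set (Planar d)} (hω : IsOpen ω)
    (hfin : volume ω ≠ ⊤) {G : Planar d → Planar d} (hG : MemLp G 2 volume)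
    (hG0 : ∀ x ∉ ω, G x = 0) {κ : ℝ} (hκ : 0 < κ) :
    ∃ Ψ : Planar d → Planar d, ContDiff ℝ (⊤ : ℕ∞) Ψ ∧ HasCompactSupport Ψ ∧ tsupport Ψ ⊆ ω ∧
      ∫ x, ‖G x - Ψ x‖ ^ 2 ≤ κ := by
  -- There are two errors of size e in the L² norm: the part of G outside K, and the smooth
  -- approximation on K; together (2e)² = κ.
  set e := Real.sqrt κ / 2 with he
  have hepos : 0 < e := by positivity
  obtain ⟨δ, hδ, hGδ⟩ := hG.eLpNorm_indicator_le (by norm_num) (by norm_num) hepos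
  obtain ⟨K, hKω, hK, hKδ⟩ := hω.measurableSet.exists_isCompact_sdiff_lt hfin
    (ENNReal.ofReal_pos.2 hδ).ne'
  have hGK : MemLp (K.indicator G) 2 volume := hG.indicator hK.measurableSet
  obtain ⟨Ψ₀, hc₀, hs₀, hΨ₀⟩ := hGK.exist_eLpNorm_sub_le (by norm_num) (by norm_num) hepos
  obtain ⟨K', hK', hKK', hK'ω⟩ := exists_compact_between hK hω hKω
  obtain ⟨χ, hχ1, hχ0, hχ⟩ := exists_contMDiffMap_one_nhds_of_subset_interior (n := (⊤ : ℕ∞))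
    (modelWithCornersSelf ℝ (Planar d)) hK.isClosed hKK'
  have hχs : ContDiff ℝ (⊤ : ℕ∞) χ := χ.contMDiff.contDiff
  set Ψ : Planar d → Planar d := fun x => χ x • Ψ₀ x with hΨ
  have hsupp : tsupport Ψ ⊆ K' := by
    refine closure_minimal (fun x hx => ?_) hK'.isClosed
    by_contra hx'
    exact hx (by simp [Ψ, hχ0 x hx'])
  have hΨc : HasCompactSupport Ψ := hK'.of_isClosed_subset (isClosed_tsupport _) hsupp
  have hΨs : ContDiff ℝ (⊤ : ℕ∞) Ψ := hχs.smul hs₀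
  have hΨ2 : MemLp Ψ 2 volume := hΨs.continuous.memLp_of_hasCompactSupport hΨc
  refine ⟨Ψ, hΨs, hΨc, hsupp.trans hK'ω, ?_⟩
  have hκe : κ = (e + e) ^ 2 := by
    rw [he, add_halves, Real.sq_sqrt hκ.le]
  rw [hκe]
  refine integral_norm_sq_le_of_eLpNorm_le (hG.sub hΨ2) (by positivity) ?_
  have hsplit : G - Ψ = (ω \ K).indicator G + (K.indicator G - Ψ) := by
    ext1 x
    by_cases hxK : x ∈ K
    · simp [hxK]
    · by_cases hxω : x ∈ ω
      · simp [hxK, hxω, sub_eq_add_neg]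
      · simp [hxK, hxω, hG0 x hxω]
  -- The cutoff does not increase the error: it equals 1 on K, and off K the target is 0 while 0 ≤ χ
  -- ≤ 1.
  have hle : eLpNorm (K.indicator G - Ψ) 2 volume ≤ eLpNorm (K.indicator G - Ψ₀) 2 volume := by
    refine eLpNorm_mono fun x => ?_
    by_cases hxK : x ∈ K
    · have : χ x = 1 := hχ1.self_of_nhdsSet x hxK
      simp [Ψ, this]
    · simp only [Pi.sub_apply, indicator_of_notMem hxK, zero_sub, norm_neg, Ψ, norm_smul]
      have h1 := hχ x
      rw [Real.norm_of_nonneg h1.1]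
      exact mul_le_of_le_one_left (norm_nonneg _) h1.2
  rw [hsplit, ENNReal.ofReal_add hepos.le hepos.le]
  refine (eLpNorm_add_le (hG.indicator (hω.measurableSet.diff hK.measurableSet)).1
    (hGK.sub hΨ2).1 (by norm_num)).trans ?_
  gcongr
  · exact hGδ _ (hω.measurableSet.diff hK.measurableSet) hKδ.le
  · exact hle.trans hΨ₀

/-- Replacement of `U ∈ L²(Ω)` by a measurable function on the whole space. -/
lemma exists_measurable_extension {Ω : Set (Full d)} (hΩ : MeasurableSet Ω) (hfin : volume Ω ≠ ⊤)
    {U : Full d → ℝ} (hU : MemLp U 2 (volume.restrict Ω)) :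
    ∃ V : Full d → ℝ, Measurable V ∧ MemLp V 2 volume ∧ Integrable V ∧
      U =ᵐ[volume.restrict Ω] V := by
  have h2 : MemLp (Ω.indicator U) 2 volume := (memLp_indicator_iff_restrict hΩ).2 hU
  have h1 : Integrable (Ω.indicator U) := by
    have : IsFiniteMeasure (volume.restrict Ω) := isFiniteMeasure_restrict.2 hfin
    rw [integrable_indicator_iff hΩ]
    exact hU.integrable (by norm_num)
  have hae := h2.1.ae_eq_mk
  refine ⟨h2.1.mk _, h2.1.stronglyMeasurable_mk.measurable, h2.ae_eq hae, h1.congr hae, ?_⟩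
  filter_upwards [ae_restrict_of_ae (s := Ω) hae, ae_restrict_mem hΩ] with x hx hxΩ
  rw [← hx, indicator_of_mem hxΩ]

/-- The convergence of the rescaled functions in terms of the unscaled ones. -/
lemma DRConvL1loc.eventually_setLIntegral_le {ω : Set (Planar d)} {ε : ℕ → ℝ} (hε : ∀ j, 0 < ε j)
    {U : ℕ → Full d → ℝ} {u : Planar d → ℝ} (h : DRConvL1loc ω ε U u) {K : Set (Planar d)}
    (hK : IsCompact K) (hKω : K ⊆ ω) {δ κ : ℝ} (hδ : 0 < δ) (hκ : 0 < κ) :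
    ∀ᶠ j in atTop, ∫⁻ x in K ×ˢ Icc (ε j * δ) (ε j * (1 - δ)), ‖U j x - u x.1‖ₑ ≤
      ENNReal.ofReal (ε j * κ) := by
  have hlim := h.tendsto (K ×ˢ Icc δ (1 - δ)) (hK.prod isCompact_Icc)
    (prod_mono hKω fun z hz => ⟨hδ.trans_le hz.1, by linarith [hz.2]⟩)
  filter_upwards [(ENNReal.tendsto_nhds_zero.1 hlim) (ENNReal.ofReal κ) (ENNReal.ofReal_pos.2 hκ)]
    with j hj
  rw [setLIntegral_prod_dilation (hε j), ENNReal.ofReal_mul (hε j).le]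
  gcongr
  exact hj

lemma eventually_lt_one_of_tendsto {s : ℝ → ℝ} (hs : Tendsto s (𝓝[>] 0) (𝓝[<] 1)) {ε : ℕ → ℝ}
    (hε : ∀ j, 0 < ε j) (hε0 : Tendsto ε atTop (𝓝 0)) :
    Tendsto (fun j => s (ε j)) atTop (𝓝 1) ∧ ∀ᶠ j in atTop, s (ε j) < 1 := by
  have h : Tendsto ε atTop (𝓝[>] 0) :=
    tendsto_nhdsWithin_iff.2 ⟨hε0, .of_forall hε⟩
  have := tendsto_nhdsWithin_iff.1 (hs.comp h)
  exact this

/-- The liminf inequality. -/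
theorem le_liminf_scaledEnergy (hd : 1 ≤ d) {ω : Set (Planar d)} (hω : IsOpen ω)
    (hbdd : Bornology.IsBounded ω) {s : ℝ → ℝ} (hs : Tendsto s (𝓝[>] 0) (𝓝[<] 1))
    {u : Planar d → ℝ} {G : Planar d → Planar d} (hu : IsH1WithGradient ω u G) {ε : ℕ → ℝ}
    (hε : ∀ j, 0 < ε j) (hε0 : Tendsto ε atTop (𝓝 0)) {U : ℕ → Full d → ℝ}
    (hU : DRConvL1loc ω ε U u) :
    ENNReal.ofReal (sphereArea d / (2 * d)) * ∫⁻ x in ω, ‖G x‖ₑ ^ 2 ≤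
      liminf (fun j => scaledEnergy ω (s (ε j)) (ε j) (U j)) atTop := by
  have hωm := hω.measurableSet
  have hωfin : volume ω ≠ ⊤ := hbdd.measure_lt_top.ne
  obtain ⟨hs1, hslt⟩ := eventually_lt_one_of_tendsto hs hε hε0
  have : IsFiniteMeasure (volume.restrict ω) := isFiniteMeasure_restrict.2 hωfin
  have hσ := @sphereArea_nonneg d
  set u' := ω.indicator u with hu'
  set G' := ω.indicator G with hG'
  have hu1 : Integrable u' := by
    rw [hu', integrable_indicator_iff hωm]
    exact hu.memLp.integrable (by norm_num)
  have hG2 : MemLp G' 2 volume := (memLp_indicator_iff_restrict hωm).2 hu.memLp_gradient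
  set N := ∫⁻ x in ω, ‖G x‖ₑ ^ 2 with hN
  have hNG : ∫⁻ x, ENNReal.ofReal (‖G' x‖ ^ 2) = N := by
    rw [hN, ← lintegral_indicator hωm]
    congr with x
    by_cases hx : x ∈ ω <;> simp [hx, hG', ENNReal.ofReal_pow]
  have hNtop : N ≠ ⊤ := by
    rw [hN, lintegral_enorm_sq_eq]
    exact ENNReal.pow_ne_top hu.memLp_gradient.2.ne
  set F := fun j => scaledEnergy ω (s (ε j)) (ε j) (U j) with hF
  have main : ∀ δ : ℝ, 0 < δ → δ < 1 / 2 → ∀ κ : ℝ, 0 < κ →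
      ENNReal.ofReal ((1 - 2 * δ) * (sphereArea d / (2 * d))) * N ≤
        liminf F atTop + ENNReal.ofReal (κ * sphereArea d / 8) := by
    intro δ hδ hδ2 κ hκ
    -- The total error κ is split into thirds: 4 · κ/12 for the distance of Ψ from the gradient, and
    -- κ/3 each for the Taylor remainder (η) and for the distance of U from u (κ'). The summands 1
    -- in the denominators of η and κ' keep them positive.
    obtain ⟨Ψ, hΨs, hΨc, hΨω, hΨG⟩ := exists_contDiff_tsupport_subset_integral_sub_sq_le hω hωfin
      hG2 (fun x hx => indicator_of_notMem hx _) (κ := κ / 12) (by positivity)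
    have hweak := integral_mul_inner_fderiv (ω := ω) (u := u') (G := G')
      (fun φ h1 h2 h3 v => hu.integral_indicator_eq hωm h1 h2 h3 v) hΨs hΨc hΨω
    obtain ⟨M, hM0, hM⟩ := exists_norm_sub_le_mul (hΨs.of_le (by simp)) hΨc
    have hI1 : 0 ≤ ∫ x, |u' x| := integral_nonneg fun x => abs_nonneg _
    set η := κ / (24 * (1 + ∫ x, |u' x|)) with hη
    have hηpos : 0 < η := by positivity
    have hηI : 8 * η * ∫ x, |u' x| ≤ κ / 3 := by
      rw [hη]
      have : 8 * (κ / (24 * (1 + ∫ x, |u' x|))) * ∫ x, |u' x| =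
        κ / 3 * ((∫ x, |u' x|) / (1 + ∫ x, |u' x|)) := by
          field_simp
          ring
      rw [this]
      exact mul_le_of_le_one_right (by positivity) ((div_le_one (by positivity)).2 (by linarith))
    obtain ⟨ρ, hρ, hΨρ⟩ := exists_norm_sub_fderiv_le (hΨs.of_le (by simp)) hΨc hηpos
    -- A thickening of fixed radius gives one compact K for all j, as local convergence requires,
    -- and it contains all planar moves once 2δε ≤ r.
    obtain ⟨r, hr, hrω⟩ := hΨc.isCompact.exists_cthickening_subset_open hω hΨω
    set K := Metric.cthickening r (tsupport Ψ) with hK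
    have hKc : IsCompact K := hΨc.isCompact.cthickening
    set κ' := κ / (24 * (1 + M)) with hκ'
    have hκ'pos : 0 < κ' := by positivity
    have hκ'M : 8 * M * κ' ≤ κ / 3 := by
      have : 8 * M * κ' = κ / 3 * (M / (1 + M)) := by
        rw [hκ']
        field_simp
        ring
      rw [this]
      exact mul_le_of_le_one_right (by positivity) ((div_le_one (by positivity)).2 (by linarith))
    have hclose := hU.eventually_setLIntegral_le hε hKc hrω hδ hκ'pos
    have hsmall : ∀ᶠ j in atTop, 2 * (δ * ε j) ≤ min ρ r := by
      have : Tendsto (fun j => 2 * (δ * ε j)) atTop (𝓝 (2 * (δ * 0))) :=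
        (hε0.const_mul δ).const_mul 2
      rw [mul_zero, mul_zero] at this
      exact (this.eventually_lt_const (lt_min hρ hr)).mono fun j hj => hj.le
    have hev : ∀ᶠ j in atTop, ENNReal.ofReal ((1 - 2 * δ) * δ ^ (2 - 2 * s (ε j)) *
        (sphereArea d / (2 * d))) * N ≤ F j + ENNReal.ofReal (κ * sphereArea d / 8) := by
      filter_upwards [hclose, hsmall, hslt] with j hj1 hj2 hj3
      by_cases hmem : MemHs (s (ε j)) (film ω (ε j)) (U j)
      swap
      · simp [F, scaledEnergy, hmem]
      have hΩm : MeasurableSet (film ω (ε j)) := hωm.prod measurableSet_Ioo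
      have hΩfin : volume (film ω (ε j)) ≠ ⊤ := by
        rw [film, Measure.volume_eq_prod, Measure.prod_prod]
        exact ENNReal.mul_ne_top hωfin (by simp)
      obtain ⟨V, hVm, hV2, hV1, hUV⟩ := exists_measurable_extension hΩm hΩfin hmem.1
      have hsub : K ×ˢ Icc (ε j * δ) (ε j * (1 - δ)) ⊆ film ω (ε j) := by
        have := hε j
        refine prod_mono hrω fun z hz => ⟨?_, ?_⟩
        · exact lt_of_lt_of_le (by positivity) hz.1
        · exact lt_of_le_of_lt hz.2 (by nlinarith)
      have hVclose : ∫ x in K ×ˢ Icc (ε j * δ) (ε j * (1 - δ)), |V x - u' x.1| ≤ ε j * κ' := by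
        have hint : IntegrableOn (fun x : Full d => |V x - u' x.1|)
            (K ×ˢ Icc (ε j * δ) (ε j * (1 - δ))) := by
          have h1 : IntegrableOn (fun x : Full d => u' x.1)
              (K ×ˢ Icc (ε j * δ) (ε j * (1 - δ))) := by
            rw [IntegrableOn, Measure.volume_eq_prod, ← Measure.prod_restrict]
            exact hu1.integrableOn.comp_fst _
          exact (hV1.integrableOn.sub h1).abs
        rw [← ENNReal.ofReal_le_ofReal_iff (by have := hε j; positivity),
          ofReal_integral_eq_lintegral_ofReal hint (.of_forall fun x => abs_nonneg _)]
        refine le_trans (le_of_eq ?_) hj1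
        refine setLIntegral_congr_fun_ae (hKc.measurableSet.prod measurableSet_Icc) ?_
        have hUV' := (ae_restrict_iff' hΩm).1 hUV
        filter_upwards [hUV'] with x hx hxK
        rw [hx (hsub hxK), hu', indicator_of_mem (hrω hxK.1), Real.enorm_eq_ofReal_abs]
      have key := le_mul_gagliardoSq hd hωm hVm hV2 hV1 hu1 hG2 hΨs hΨc hweak hj3 (hε j) hδ hδ2 hM0
        hηpos.le hM (fun x z hz => hΨρ x z (hz.trans (hj2.trans (min_le_left _ _))))
        hKc.measurableSet (fun x hx z hz => Metric.mem_cthickening_of_dist_le _ x _ _ hx (by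
          simpa using hz.trans (hj2.trans (min_le_right _ _)))) hrω hVclose (C := κ) hκ.le
        (by linarith)
      rw [hNG] at key
      refine key.trans ?_
      simp only [F, scaledEnergy, hmem, if_true, gagliardoSq_congr_ae hUV]
      have hpow : δ ^ (2 - 2 * s (ε j)) ≤ 1 :=
        Real.rpow_le_one hδ.le (by linarith) (by linarith)
      have hpow' := mul_le_of_le_one_right (a := κ * sphereArea d) (by positivity) hpow
      gcongr
    have hlim : Tendsto (fun j => ENNReal.ofReal ((1 - 2 * δ) * δ ^ (2 - 2 * s (ε j)) *
        (sphereArea d / (2 * d))) * N) atTop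
        (𝓝 (ENNReal.ofReal ((1 - 2 * δ) * (sphereArea d / (2 * d))) * N)) := by
      refine ENNReal.Tendsto.mul_const (ENNReal.tendsto_ofReal ?_) (Or.inr ?_)
      -- For fixed δ, δ^{2-2s} → 1 as s → 1: restricting the kernel to the ball of radius δε loses
      -- nothing in the limit, because the energy concentrates on the diagonal.
      · have h1 : Tendsto (fun j => δ ^ (2 - 2 * s (ε j))) atTop (𝓝 (δ ^ (2 - 2 * (1 : ℝ)))) :=
          (tendsto_const_nhds (x := δ)).rpow ((hs1.const_mul 2).const_sub 2) (Or.inl hδ.ne')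
        have h2 : δ ^ (2 - 2 * (1 : ℝ)) = 1 := by norm_num
        rw [h2] at h1
        simpa using (h1.const_mul (1 - 2 * δ)).mul_const (sphereArea d / (2 * d))
      · exact hNtop
    have hle := liminf_le_liminf hev
    rw [hlim.liminf_eq] at hle
    refine hle.trans (le_of_eq ?_)
    exact liminf_add_const atTop F _ (by isBoundedDefault) (by isBoundedDefault)
  have main' : ∀ δ : ℝ, 0 < δ → δ < 1 / 2 →
      ENNReal.ofReal ((1 - 2 * δ) * (sphereArea d / (2 * d))) * N ≤ liminf F atTop := by
    intro δ hδ hδ2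
    have hlim : Tendsto (fun κ : ℝ => liminf F atTop + ENNReal.ofReal (κ * sphereArea d / 8))
        (𝓝[>] 0) (𝓝 (liminf F atTop + ENNReal.ofReal (0 * sphereArea d / 8))) := by
      refine tendsto_const_nhds.add (ENNReal.tendsto_ofReal ?_)
      exact ((continuous_id.mul_const _).div_const _).continuousWithinAt
    have := ge_of_tendsto hlim (eventually_mem_nhdsWithin.mono fun κ hκ => main δ hδ hδ2 κ hκ)
    simpa using this
  have hlim : Tendsto (fun δ : ℝ => ENNReal.ofReal ((1 - 2 * δ) * (sphereArea d / (2 * d))) * N)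
      (𝓝[>] 0) (𝓝 (ENNReal.ofReal ((1 - 2 * 0) * (sphereArea d / (2 * d))) * N)) := by
    refine ENNReal.Tendsto.mul_const (ENNReal.tendsto_ofReal ?_) (Or.inr hNtop)
    have : Continuous fun δ : ℝ => (1 - 2 * δ) * (sphereArea d / (2 * d)) := by fun_prop
    exact this.continuousWithinAt
  have := le_of_tendsto hlim (by
    filter_upwards [Ioo_mem_nhdsGT (show (0 : ℝ) < 1 / 2 by norm_num)] with δ hδ
    exact main' δ hδ.1 hδ.2)
  simpa using this

end

/-! ### Energy of smooth functions of the planar variables. -/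

section

variable {d : ℕ}

/-- The gradient of a function on `ℝ^{d-1}`. -/
def grad (v : Planar d → ℝ) (x : Planar d) : Planar d :=
  (InnerProductSpace.toDual ℝ (Planar d)).symm (fderiv ℝ v x)

lemma inner_grad (v : Planar d → ℝ) (x z : Planar d) : inner ℝ (grad v x) z = fderiv ℝ v x z :=
  InnerProductSpace.toDual_symm_apply

lemma continuous_grad {v : Planar d → ℝ} (hv : ContDiff ℝ 1 v) : Continuous (grad v) :=
  (InnerProductSpace.toDual ℝ (Planar d)).symm.continuous.comp (hv.continuous_fderiv one_ne_zero)

/-- As v is defined everywhere, the condition x + h ∈ Ω can be dropped; the integrand no longer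
depends on the height, which contributes the factor ε. -/
lemma incrSq_comp_fst_le {ω : Set (Planar d)} (v : Planar d → ℝ) (hv : Continuous v) {ε : ℝ}
    (h : Full d) :
    incrSq (film ω ε) (fun x => v x.1) h ≤
      ENNReal.ofReal ε * ∫⁻ x in ω, ENNReal.ofReal ((v (x + h.1) - v x) ^ 2) := by
  refine (lintegral_mono_set inter_subset_left).trans (le_of_eq ?_)
  rw [film, Measure.volume_eq_prod, ← Measure.prod_restrict, lintegral_prod _ (by fun_prop)]
  simp only [Prod.fst_add, lintegral_const, Measure.restrict_apply_univ, Real.volume_Ioo, sub_zero]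
  rw [lintegral_mul_const _ (by fun_prop), mul_comm]

/-- Two points of the film have heights differing by less than ε. -/
lemma incrSq_eq_zero {ω : Set (Planar d)} (u : Full d → ℝ) {ε : ℝ} {h : Full d} (hh : ε ≤ |h.2|) :
    incrSq (film ω ε) u h = 0 := by
  have : film ω ε ∩ (fun x => x + h) ⁻¹' film ω ε = ∅ := by
    ext x
    simp only [film, mem_inter_iff, mem_prod, mem_preimage, mem_Ioo, Prod.snd_add, Prod.fst_add,
      mem_empty_iff_false, iff_false, not_and]
    rintro ⟨_, h1, h2⟩ _ h3
    rcases le_abs'.1 hh with h4 | h4 <;> linarith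
  rw [incrSq, this]
  simp

/-- Far from the diagonal a function of the planar variables has small energy. -/
lemma setLIntegral_compl_kernel_mul_incrSq_le (hd : 2 ≤ d) {ω : Set (Planar d)}
    {v : Planar d → ℝ} (hv : Continuous v) {M : ℝ}
    (hM : ∀ x z, ‖v (x + z) - v x‖ ≤ M * ‖z‖) {s ε C : ℝ} (hs : 3 / 4 ≤ s) (hε : 0 < ε)
    (hC : ∫⁻ y : Planar d in {y | ε ≤ ‖y‖}, ENNReal.ofReal (‖y‖ ^ (2 - (d : ℝ) - 2 * s)) ≤
      ENNReal.ofReal (C * ε ^ (1 - 2 * s))) :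
    ∫⁻ h in {h : Full d | euclNorm h < 2 * ε}ᶜ, kernel s h *
      incrSq (film ω ε) (fun x => v x.1) h ≤
      ENNReal.ofReal (ε * M ^ 2) * volume ω *
        (ENNReal.ofReal (2 * ε) * ENNReal.ofReal (C * ε ^ (1 - 2 * s))) := by
  -- If |h| ≥ 2ε and |h_d| < ε then |h'| ≥ ε, since otherwise |h|² < 2ε². The remaining region is
  -- thus a planar tail times an interval of length 2ε.
  set S : Set (Full d) := {y | ε ≤ ‖y‖} ×ˢ Ioo (-ε) ε with hS
  have hSm : MeasurableSet S :=
    (measurableSet_le measurable_const measurable_norm).prod measurableSet_Ioo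
  have hBm : MeasurableSet {h : Full d | euclNorm h < 2 * ε}ᶜ :=
    (measurableSet_lt (by fun_prop) measurable_const).compl
  have hpt : ∀ h ∈ {h : Full d | euclNorm h < 2 * ε}ᶜ,
      kernel s h * incrSq (film ω ε) (fun x => v x.1) h ≤
        S.indicator (fun h => ENNReal.ofReal (ε * M ^ 2) * volume ω *
          ENNReal.ofReal (‖h.1‖ ^ (2 - (d : ℝ) - 2 * s))) h := by
    intro h hh
    have hh : 2 * ε ≤ euclNorm h := not_lt.1 hh
    by_cases h2 : ε ≤ |h.2|
    · simp [incrSq_eq_zero _ h2]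
    · have h2 : |h.2| < ε := not_le.1 h2
      have h1 : ε ≤ ‖h.1‖ := by
        by_contra! hlt
        have : euclNorm h < 2 * ε := by
          rw [euclNorm, Real.sqrt_lt' (by positivity), ← sq_abs h.2]
          nlinarith [norm_nonneg h.1, abs_nonneg h.2]
        linarith
      have hpos : 0 < ‖h.1‖ := hε.trans_le h1
      have hmem : h ∈ S := ⟨h1, abs_lt.1 h2⟩
      rw [indicator_of_mem hmem]
      have hincr : incrSq (film ω ε) (fun x => v x.1) h ≤
          ENNReal.ofReal (ε * M ^ 2) * volume ω * ENNReal.ofReal (‖h.1‖ ^ 2) := by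
        refine (incrSq_comp_fst_le v hv h).trans ?_
        calc _ ≤ ENNReal.ofReal ε * ∫⁻ x in ω, ENNReal.ofReal ((M * ‖h.1‖) ^ 2) := by
              refine mul_le_mul_right (lintegral_mono fun x => ENNReal.ofReal_le_ofReal ?_) _
              refine sq_le_sq' ?_ ?_
              · linarith [neg_abs_le (v (x + h.1) - v x), hM x h.1, Real.norm_eq_abs (v (x + h.1) - v x)]
              · exact (le_abs_self _).trans (hM x h.1)
          _ = _ := by
              rw [setLIntegral_const, mul_pow, ENNReal.ofReal_mul (sq_nonneg _),
                ENNReal.ofReal_mul hε.le]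
              ring
      have hker : kernel s h * ENNReal.ofReal (‖h.1‖ ^ 2) ≤
          ENNReal.ofReal (‖h.1‖ ^ (2 - (d : ℝ) - 2 * s)) := by
        rw [← ofReal_div_euclNorm]
        apply ENNReal.ofReal_le_ofReal
        rw [show 2 - (d : ℝ) - 2 * s = 2 - (d + 2 * s) by ring, Real.rpow_sub hpos,
          Real.rpow_two]
        gcongr
        exact norm_fst_le_euclNorm h
      calc _ ≤ kernel s h * (ENNReal.ofReal (ε * M ^ 2) * volume ω * ENNReal.ofReal (‖h.1‖ ^ 2)) := by
            gcongr
        _ = ENNReal.ofReal (ε * M ^ 2) * volume ω * (kernel s h * ENNReal.ofReal (‖h.1‖ ^ 2)) := by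
            ring
        _ ≤ _ := by gcongr
  calc _ ≤ ∫⁻ h in {h : Full d | euclNorm h < 2 * ε}ᶜ,
        S.indicator (fun h => ENNReal.ofReal (ε * M ^ 2) * volume ω *
          ENNReal.ofReal (‖h.1‖ ^ (2 - (d : ℝ) - 2 * s))) h := setLIntegral_mono' hBm hpt
    _ ≤ ∫⁻ h, S.indicator (fun h => ENNReal.ofReal (ε * M ^ 2) * volume ω *
          ENNReal.ofReal (‖h.1‖ ^ (2 - (d : ℝ) - 2 * s))) h := setLIntegral_le_lintegral _ _
    _ = ENNReal.ofReal (ε * M ^ 2) * volume ω * (ENNReal.ofReal (2 * ε) *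
        ∫⁻ y : Planar d in {y | ε ≤ ‖y‖}, ENNReal.ofReal (‖y‖ ^ (2 - (d : ℝ) - 2 * s))) := by
        rw [lintegral_indicator hSm, lintegral_const_mul _ (by fun_prop), hS,
          Measure.volume_eq_prod, ← Measure.prod_restrict, lintegral_prod _ (by fun_prop)]
        simp only [lintegral_const, Measure.restrict_apply_univ, Real.volume_Ioo]
        rw [lintegral_mul_const _ (by fun_prop), sub_neg_eq_add, two_mul ε,
          mul_comm (ENNReal.ofReal (ε + ε))]
    _ ≤ _ := by gcongr

/-- Near the diagonal the energy of a smooth function of the planar variables is controlled by its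
Dirichlet integral. -/
lemma setLIntegral_kernel_mul_incrSq_le (hd : 1 ≤ d) {ω : Set (Planar d)}
    {v : Planar d → ℝ} (hv : ContDiff ℝ 1 v) {κ : ℝ} (hκ : 0 ≤ κ) {s R ε : ℝ} (hs : s < 1)
    (hR : 0 < R)
    (hvR : ∀ x z, ‖z‖ ≤ R → (v (x + z) - v x) ^ 2 ≤ inner ℝ (grad v x) z ^ 2 + κ * ‖z‖ ^ 2) :
    ∫⁻ h in {h : Full d | euclNorm h < R}, kernel s h *
      incrSq (film ω ε) (fun x => v x.1) h ≤
      ENNReal.ofReal ε *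
        (ENNReal.ofReal (sphereArea d / d * (R ^ (2 - 2 * s) / (2 - 2 * s))) *
          (∫⁻ x in ω, ‖grad v x‖ₑ ^ 2) + ENNReal.ofReal κ * volume ω *
          ENNReal.ofReal (sphereArea d * (R ^ (2 - 2 * s) / (2 - 2 * s)))) := by
  have hg := continuous_grad hv
  have hN : ∫⁻ x in ω, ‖grad v x‖ₑ ^ 2 = ∫⁻ x in ω, ENNReal.ofReal (‖grad v x‖ ^ 2) := by
    congr with x
    simp [ENNReal.ofReal_pow]
  rw [hN, ← setLIntegral_kernel_mul_lintegral_inner_sq hd hg.aestronglyMeasurable hs hR]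
  calc _ ≤ ∫⁻ h in {h : Full d | euclNorm h < R}, ENNReal.ofReal ε *
        (kernel s h * (∫⁻ x in ω, ENNReal.ofReal (inner ℝ (grad v x) h.1 ^ 2)) +
          ENNReal.ofReal κ * volume ω * (kernel s h * ENNReal.ofReal (‖h.1‖ ^ 2))) := by
        refine setLIntegral_mono' (measurableSet_lt (by fun_prop) measurable_const) fun h hh => ?_
        have hh' : ‖h.1‖ ≤ R := (norm_fst_le_euclNorm h).trans (le_of_lt hh)
        have : ∫⁻ x in ω, ENNReal.ofReal ((v (x + h.1) - v x) ^ 2) ≤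
            (∫⁻ x in ω, ENNReal.ofReal (inner ℝ (grad v x) h.1 ^ 2)) +
              ENNReal.ofReal κ * volume ω * ENNReal.ofReal (‖h.1‖ ^ 2) := by
          calc _ ≤ ∫⁻ x in ω, (ENNReal.ofReal (inner ℝ (grad v x) h.1 ^ 2) +
                ENNReal.ofReal κ * ENNReal.ofReal (‖h.1‖ ^ 2)) := by
                refine lintegral_mono fun x => ?_
                rw [← ENNReal.ofReal_mul hκ, ← ENNReal.ofReal_add (sq_nonneg _) (by positivity)]
                exact ENNReal.ofReal_le_ofReal (hvR x h.1 hh')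
            _ = _ := by
                rw [lintegral_add_right _ measurable_const, setLIntegral_const]
                ring
        calc _ ≤ kernel s h * (ENNReal.ofReal ε * ((∫⁻ x in ω,
              ENNReal.ofReal (inner ℝ (grad v x) h.1 ^ 2)) +
              ENNReal.ofReal κ * volume ω * ENNReal.ofReal (‖h.1‖ ^ 2))) := by
              gcongr
              exact (incrSq_comp_fst_le v hv.continuous h).trans (by gcongr)
          _ = _ := by ring
    _ = ENNReal.ofReal ε * ((∫⁻ h in {h : Full d | euclNorm h < R},
        kernel s h * (∫⁻ x in ω, ENNReal.ofReal (inner ℝ (grad v x) h.1 ^ 2))) +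
          ENNReal.ofReal κ * volume ω * ∫⁻ h in {h : Full d | euclNorm h < R},
            (kernel s h * ENNReal.ofReal (‖h.1‖ ^ 2))) := by
        rw [lintegral_const_mul' _ _ ENNReal.ofReal_ne_top, lintegral_add_right _ (by fun_prop),
          lintegral_const_mul _ (by fun_prop)]
    _ ≤ _ := by
        gcongr
        simp_rw [← ofReal_div_euclNorm]
        exact setLIntegral_norm_sq_div_le hd hs hR

/-- The energy of a smooth function of the planar variables. -/
lemma mul_gagliardoSq_comp_fst_le (hd : 2 ≤ d) {ω : Set (Planar d)} (hω : MeasurableSet ω)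
    {v : Planar d → ℝ} (hv : ContDiff ℝ 1 v) {M : ℝ}
    (hM : ∀ x z, ‖v (x + z) - v x‖ ≤ M * ‖z‖) {κ : ℝ} (hκ : 0 ≤ κ)
    {s ε C : ℝ} (hs : s < 1) (hs' : 3 / 4 ≤ s) (hε : 0 < ε)
    (hC : ∫⁻ y : Planar d in {y | ε ≤ ‖y‖}, ENNReal.ofReal (‖y‖ ^ (2 - (d : ℝ) - 2 * s)) ≤
      ENNReal.ofReal (C * ε ^ (1 - 2 * s)))
    (hvR : ∀ x z, ‖z‖ ≤ 2 * ε → (v (x + z) - v x) ^ 2 ≤ inner ℝ (grad v x) z ^ 2 + κ * ‖z‖ ^ 2) :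
    ENNReal.ofReal ((1 - s) / ε ^ (3 - 2 * s)) * gagliardoSq s (film ω ε) (fun x => v x.1) ≤
      ENNReal.ofReal (2 ^ (2 - 2 * s) * (sphereArea d / (2 * d))) * (∫⁻ x in ω, ‖grad v x‖ₑ ^ 2) +
        ENNReal.ofReal (κ * (2 ^ (2 - 2 * s) * (sphereArea d / 2))) * volume ω +
        ENNReal.ofReal (2 * C * M ^ 2 * (1 - s)) * volume ω := by
  have hp : 0 ≤ (1 - s) / ε ^ (3 - 2 * s) := div_nonneg (by linarith) (Real.rpow_nonneg hε.le _)
  have hσ := @sphereArea_nonneg d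
  have h22 : 0 < 2 - 2 * s := by linarith
  have hRs : (2 * ε) ^ (2 - 2 * s) = 2 ^ (2 - 2 * s) * ε ^ (2 - 2 * s) :=
    Real.mul_rpow zero_le_two hε.le
  have hεs : ε ^ (3 - 2 * s) = ε * ε ^ (2 - 2 * s) := by
    rw [show 3 - 2 * s = 1 + (2 - 2 * s) by ring, Real.rpow_add hε, Real.rpow_one]
  have hεs' : ε ^ (2 - 2 * s) = ε * ε ^ (1 - 2 * s) := by
    rw [show 2 - 2 * s = 1 + (1 - 2 * s) by ring, Real.rpow_add hε, Real.rpow_one]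
  have hεp : 0 < ε ^ (1 - 2 * s) := Real.rpow_pos_of_pos hε _
  have hd0 : (0 : ℝ) < d := by exact_mod_cast (by omega : 0 < d)
  have h1s : 1 - s ≠ 0 := by linarith
  have hvm : Measurable fun x : Full d => v x.1 := (hv.continuous.comp continuous_fst).measurable
  rw [gagliardoSq_eq_lintegral_incrSq (Ω := film ω ε) (hω.prod measurableSet_Ioo) hvm,
    ← lintegral_add_compl _ (measurableSet_lt measurable_euclNorm
      (measurable_const (a := 2 * ε)))]
  refine (mul_le_mul_right (add_le_add
    (setLIntegral_kernel_mul_incrSq_le (by omega) hv hκ hs (by positivity) hvR)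
    (setLIntegral_compl_kernel_mul_incrSq_le hd hv.continuous hM hs' hε hC)) _).trans (le_of_eq ?_)
  have e1 : ENNReal.ofReal (2 ^ (2 - 2 * s) * (sphereArea d / (2 * d))) =
      ENNReal.ofReal ((1 - s) / ε ^ (3 - 2 * s)) * ENNReal.ofReal ε *
        ENNReal.ofReal (sphereArea d / d * ((2 * ε) ^ (2 - 2 * s) / (2 - 2 * s))) := by
    rw [← ENNReal.ofReal_mul hp, ← ENNReal.ofReal_mul (by positivity)]
    congr 1
    rw [hRs, hεs, hεs', show 2 - 2 * s = 2 * (1 - s) by ring]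
    field_simp
  have e2 : ENNReal.ofReal (κ * (2 ^ (2 - 2 * s) * (sphereArea d / 2))) =
      ENNReal.ofReal ((1 - s) / ε ^ (3 - 2 * s)) * ENNReal.ofReal ε * ENNReal.ofReal κ *
        ENNReal.ofReal (sphereArea d * ((2 * ε) ^ (2 - 2 * s) / (2 - 2 * s))) := by
    rw [← ENNReal.ofReal_mul hp, ← ENNReal.ofReal_mul (by positivity),
      ← ENNReal.ofReal_mul (by positivity)]
    congr 1
    rw [hRs, hεs, hεs', show 2 - 2 * s = 2 * (1 - s) by ring]
    field_simp
  -- The far part has order ε · ε · ε^{1-2s} = ε^{3-2s}, which the scaling cancels exactly; the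
  -- prefactor 1-s survives and sends it to 0.
  have e3 : ENNReal.ofReal (2 * C * M ^ 2 * (1 - s)) =
      ENNReal.ofReal ((1 - s) / ε ^ (3 - 2 * s)) * ENNReal.ofReal (ε * M ^ 2) *
        (ENNReal.ofReal (2 * ε) * ENNReal.ofReal (C * ε ^ (1 - 2 * s))) := by
    rw [← ENNReal.ofReal_mul hp, ← ENNReal.ofReal_mul (by positivity),
      ← ENNReal.ofReal_mul (by positivity)]
    congr 1
    rw [hεs, hεs']
    field_simp
  rw [e1, e2, e3]
  ring

/-- With A the increment and B its linear part, A² - B² ≤ 2|A||A - B|; here |A| ≤ M|z|, and the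
remainder is made at most κ|z|/(2M+1). -/
lemma exists_sq_sub_le_inner_grad_sq {v : Planar d → ℝ} (hv : ContDiff ℝ 1 v)
    (hc : HasCompactSupport v) {κ : ℝ} (hκ : 0 < κ) :
    ∃ ρ > 0, ∀ x z, ‖z‖ ≤ ρ → (v (x + z) - v x) ^ 2 ≤ inner ℝ (grad v x) z ^ 2 + κ * ‖z‖ ^ 2 := by
  obtain ⟨M, hM0, hM⟩ := exists_norm_sub_le_mul hv hc
  obtain ⟨ρ, hρ, h⟩ := exists_norm_sub_fderiv_le hv hc (η := κ / (2 * M + 1)) (by positivity)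
  refine ⟨ρ, hρ, fun x z hz => ?_⟩
  have h1 := h x z hz
  have h2 := hM x z
  rw [← inner_grad, Real.norm_eq_abs] at h1
  rw [Real.norm_eq_abs] at h2
  set A := v (x + z) - v x
  set B := inner ℝ (grad v x) z
  set n := ‖z‖
  have hn : 0 ≤ n := norm_nonneg z
  have hη : κ / (2 * M + 1) * (2 * M) ≤ κ := by
    rw [div_mul_eq_mul_div, div_le_iff₀ (by positivity)]
    nlinarith
  have h3 : A ^ 2 ≤ B ^ 2 + 2 * |A| * |A - B| := by
    rw [mul_assoc, ← abs_mul]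
    nlinarith [le_abs_self (A * (A - B)), sq_nonneg (A - B)]
  have h4 : |A| * |A - B| ≤ (M * n) * (κ / (2 * M + 1) * n) := by gcongr
  nlinarith [sq_nonneg n]

/-- The upper bound of the energies of a smooth function of the planar variables. -/
lemma eventually_scaledEnergy_comp_fst_le (hd : 2 ≤ d) {ω : Set (Planar d)} (hω : MeasurableSet ω)
    (hωfin : volume ω ≠ ⊤) {s : ℝ → ℝ} (hs : Tendsto s (𝓝[>] 0) (𝓝[<] 1)) {ε : ℕ → ℝ}
    (hε : ∀ j, 0 < ε j) (hε0 : Tendsto ε atTop (𝓝 0)) {v : Planar d → ℝ} (hv : ContDiff ℝ 1 v)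
    (hc : HasCompactSupport v) {θ : ℝ} (hθ : 0 < θ) :
    ∀ᶠ j in atTop, scaledEnergy ω (s (ε j)) (ε j) (fun x => v x.1) ≤
      ENNReal.ofReal (sphereArea d / (2 * d)) * (∫⁻ x in ω, ‖grad v x‖ₑ ^ 2) +
        ENNReal.ofReal θ := by
  obtain ⟨hs1, hslt⟩ := eventually_lt_one_of_tendsto hs hε hε0
  have hσ := @sphereArea_nonneg d
  have : IsFiniteMeasure (volume.restrict ω) := isFiniteMeasure_restrict.2 hωfin
  set N := ∫⁻ x in ω, ‖grad v x‖ₑ ^ 2 with hN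
  obtain ⟨M, hM0, hM⟩ := exists_norm_sub_le_mul hv hc
  have hNtop : N ≠ ⊤ := by
    have hgc : HasCompactSupport (grad v) := by
      refine (hc.fderiv ℝ).comp_left (g := (InnerProductSpace.toDual ℝ (Planar d)).symm) ?_
      simp
    rw [hN, lintegral_enorm_sq_eq]
    exact ENNReal.pow_ne_top
      (((continuous_grad hv).memLp_of_hasCompactSupport hgc).restrict ω).2.ne
  obtain ⟨C, hC0, hC⟩ := exists_setLIntegral_tail_le hd
  set m := volume.real ω with hm
  have hm' : volume ω = ENNReal.ofReal m := (ofReal_measureReal hωfin).symm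
  have hm0 : 0 ≤ m := measureReal_nonneg
  -- Makes the limiting Taylor error κ (σ_d/2) |ω| strictly less than θ, so that the bound holds for
  -- all large j.
  set κ := θ / (1 + sphereArea d / 2 * m) with hκ
  have hκpos : 0 < κ := by positivity
  have hκθ : κ * (1 * (sphereArea d / 2)) * m < θ := by
    have : κ * (1 * (sphereArea d / 2)) * m =
        θ * ((sphereArea d / 2 * m) / (1 + sphereArea d / 2 * m)) := by
      rw [hκ]
      field_simp
    rw [this]
    exact mul_lt_of_lt_one_right hθ ((div_lt_one (by positivity)).2 (by linarith))
  obtain ⟨ρ, hρ, hvρ⟩ := exists_sq_sub_le_inner_grad_sq hv hc hκpos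
  have hsmall : ∀ᶠ j in atTop, 2 * ε j ≤ ρ := by
    have : Tendsto (fun j => 2 * ε j) atTop (𝓝 (2 * 0)) := hε0.const_mul 2
    rw [mul_zero] at this
    exact (this.eventually_lt_const hρ).mono fun j hj => hj.le
  have hpow : Tendsto (fun j => (2 : ℝ) ^ (2 - 2 * s (ε j))) atTop (𝓝 1) := by
    have h1 : Tendsto (fun j => (2 : ℝ) ^ (2 - 2 * s (ε j))) atTop
        (𝓝 ((2 : ℝ) ^ (2 - 2 * (1 : ℝ)))) :=
      (tendsto_const_nhds (x := (2 : ℝ))).rpow ((hs1.const_mul 2).const_sub 2) (Or.inl two_ne_zero)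
    have h2 : (2 : ℝ) ^ (2 - 2 * (1 : ℝ)) = 1 := by norm_num
    rwa [h2] at h1
  have hlim : Tendsto (fun j =>
      ENNReal.ofReal (2 ^ (2 - 2 * s (ε j)) * (sphereArea d / (2 * d))) * N +
        ENNReal.ofReal (κ * (2 ^ (2 - 2 * s (ε j)) * (sphereArea d / 2))) * volume ω +
        ENNReal.ofReal (2 * C * M ^ 2 * (1 - s (ε j))) * volume ω) atTop
      (𝓝 (ENNReal.ofReal (1 * (sphereArea d / (2 * d))) * N +
        ENNReal.ofReal (κ * (1 * (sphereArea d / 2))) * volume ω +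
        ENNReal.ofReal (2 * C * M ^ 2 * (1 - 1)) * volume ω)) := by
    refine ((ENNReal.Tendsto.mul_const (ENNReal.tendsto_ofReal (hpow.mul_const _))
      (Or.inr hNtop)).add (ENNReal.Tendsto.mul_const (ENNReal.tendsto_ofReal
      ((hpow.mul_const _).const_mul _)) (Or.inr hωfin))).add
      (ENNReal.Tendsto.mul_const (ENNReal.tendsto_ofReal ((hs1.const_sub 1).const_mul _))
      (Or.inr hωfin))
  have hlt : ENNReal.ofReal (1 * (sphereArea d / (2 * d))) * N +
        ENNReal.ofReal (κ * (1 * (sphereArea d / 2))) * volume ω +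
        ENNReal.ofReal (2 * C * M ^ 2 * (1 - 1)) * volume ω <
      ENNReal.ofReal (sphereArea d / (2 * d)) * N + ENNReal.ofReal θ := by
    rw [sub_self, mul_zero, ENNReal.ofReal_zero, zero_mul, add_zero, one_mul]
    refine ENNReal.add_lt_add_left (ENNReal.mul_ne_top ENNReal.ofReal_ne_top hNtop) ?_
    rw [hm', ← ENNReal.ofReal_mul (by positivity)]
    exact (ENNReal.ofReal_lt_ofReal_iff hθ).2 hκθ
  filter_upwards [hlim.eventually_lt_const hlt, hsmall, hslt,
    hs1.eventually_const_le (show (3 / 4 : ℝ) < 1 by norm_num)] with j h1 h2 h3 h4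
  have hle := (mul_gagliardoSq_comp_fst_le hd hω hv hM hκpos.le h3 h4 (hε j)
    (hC _ _ h4 (hε j)) (fun x z hz => hvρ x z (hz.trans h2))).trans h1.le
  have hmem : MemHs (s (ε j)) (film ω (ε j)) (fun x => v x.1) := by
    constructor
    · obtain ⟨B, hB⟩ := hc.exists_bound_of_continuous hv.continuous
      have : IsFiniteMeasure (volume.restrict (film ω (ε j))) := by
        refine isFiniteMeasure_restrict.2 ?_
        rw [film, Measure.volume_eq_prod, Measure.prod_prod]
        exact ENNReal.mul_ne_top hωfin (by simp)
      exact MemLp.of_bound (hv.continuous.comp continuous_fst).aestronglyMeasurable B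
        (.of_forall fun x => hB x.1)
    -- Finiteness of the seminorm is read off the upper bound itself, since the prefactor is
    -- positive.
    · have hfin := hle.trans_lt (ENNReal.add_lt_top.2
        ⟨ENNReal.mul_lt_top ENNReal.ofReal_lt_top hNtop.lt_top, ENNReal.ofReal_lt_top⟩)
      have hp : 0 < (1 - s (ε j)) / ε j ^ (3 - 2 * s (ε j)) :=
        div_pos (by linarith) (Real.rpow_pos_of_pos (hε j) _)
      exact ENNReal.lt_top_of_mul_ne_top_right hfin.ne (ENNReal.ofReal_pos.2 hp).ne'
  simpa [scaledEnergy, hmem] using hle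

end

/-! ### Mollification in L². -/

section

variable {d : ℕ}

section Mollification

variable {W : Type*} [NormedAddCommGroup W]

/-- Translations are continuous in `L²`. -/
lemma exists_eLpNorm_translate_sub_le {f : Planar d → W} (hf : MemLp f 2 volume) {η : ℝ}
    (hη : 0 < η) :
    ∃ τ > 0, ∀ y : Planar d, ‖y‖ < τ →
      eLpNorm (fun x => f (x - y) - f x) 2 volume ≤ ENNReal.ofReal η := by
  have : Fact ((1 : ℝ≥0∞) ≤ 2) := ⟨by norm_num⟩
  have : Fact ((2 : ℝ≥0∞) ≠ ⊤) := ⟨by norm_num⟩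
  have hcont : Continuous fun y : Planar d => (DomAddAct.mk y +ᵥ hf.toLp f : Lp W 2 volume) := by
    fun_prop
  have h0 : (DomAddAct.mk (0 : Planar d) +ᵥ hf.toLp f : Lp W 2 volume) = hf.toLp f := by simp
  have hlim := hcont.tendsto 0
  rw [h0] at hlim
  obtain ⟨τ, hτ, h⟩ := Metric.eventually_nhds_iff.1
    ((EMetric.tendsto_nhds.1 hlim) (ENNReal.ofReal η) (ENNReal.ofReal_pos.2 hη))
  refine ⟨τ, hτ, fun y hy => ?_⟩
  have h1 := h (y := -y) (by simpa using hy)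
  rw [DomAddAct.mk_vadd_toLp, Lp.edist_toLp_toLp] at h1
  refine le_trans (le_of_eq ?_) h1.le
  congr with x
  simp [sub_eq_neg_add]

variable [NormedSpace ℝ W]

/-- The mollification of `f` with the kernel `ρ`. -/
def mollify (ρ : Planar d → ℝ) (f : Planar d → W) (x : Planar d) : W := ∫ t, ρ (x - t) • f t

lemma integrable_mollify_integrand {ρ : Planar d → ℝ} (hρ : Continuous ρ) (hc : HasCompactSupport ρ)
    {f : Planar d → W} (hf : LocallyIntegrable f) (x : Planar d) :
    Integrable fun t => ρ (x - t) • f t := by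
  have hs : HasCompactSupport fun t => ρ (x - t) := hc.comp_homeomorph (Homeomorph.subLeft x)
  exact hf.integrable_smul_left_of_hasCompactSupport (by fun_prop) hs

lemma enorm_mollify_sub_sq_le [CompleteSpace W] {ρ : Planar d → ℝ} (hρ : Continuous ρ)
    (hc : HasCompactSupport ρ) (h0 : ∀ x, 0 ≤ ρ x) (h1 : ∫ x, ρ x = 1)
    {f : Planar d → W} (hf : LocallyIntegrable f) (x : Planar d) :
    ‖mollify ρ f x - f x‖ₑ ^ 2 ≤ ∫⁻ t, ENNReal.ofReal (ρ t) * ‖f (x - t) - f x‖ₑ ^ 2 := by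
  have hρi : Integrable ρ := hρ.integrable_of_hasCompactSupport hc
  -- Under the probability measure ρ dt, mollification minus identity is the mean of f(x - t) -
  -- f(x), and the square of the mean is at most the mean of the squares.
  set P : Measure (Planar d) := volume.withDensity fun t => ENNReal.ofReal (ρ t) with hP
  have hprob : IsProbabilityMeasure P := by
    refine ⟨?_⟩
    rw [hP, withDensity_apply _ .univ, setLIntegral_univ,
      ← ofReal_integral_eq_lintegral_ofReal hρi (.of_forall h0), h1, ENNReal.ofReal_one]
  have hwd : ∀ g : Planar d → ℝ≥0∞, AEMeasurable g volume →
      ∫⁻ t, g t ∂P = ∫⁻ t, ENNReal.ofReal (ρ t) * g t := by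
    intro g hg
    rw [hP, lintegral_withDensity_eq_lintegral_mul₀ (by fun_prop) hg]
    rfl
  have hfm : AEStronglyMeasurable (fun t => f (x - t) - f x) volume :=
    (hf.aestronglyMeasurable.comp_quasiMeasurePreserving
      (quasiMeasurePreserving_sub_left volume x)).sub aestronglyMeasurable_const
  have hfP : AEStronglyMeasurable (fun t => f (x - t) - f x) P :=
    hfm.mono_ac (withDensity_absolutelyContinuous _ _)
  have hint : Integrable fun t => ρ t • f (x - t) := by
    have := (integrable_mollify_integrand hρ hc hf x).comp_sub_left x
    simpa using this
  have heq : mollify ρ f x - f x = ∫ t, ρ t • (f (x - t) - f x) := by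
    simp_rw [smul_sub]
    rw [integral_sub hint (hρi.smul_const _), integral_smul_const, h1, one_smul, mollify,
      ← integral_sub_left_eq_self _ volume x]
    simp
  calc ‖mollify ρ f x - f x‖ₑ ^ 2 ≤ (∫⁻ t, ‖f (x - t) - f x‖ₑ ∂P) ^ 2 := by
        gcongr
        rw [heq, hwd _ hfm.enorm]
        refine (enorm_integral_le_lintegral_enorm _).trans (le_of_eq ?_)
        congr with t
        rw [enorm_smul, Real.enorm_of_nonneg (h0 t)]
    _ ≤ (eLpNorm (fun t => f (x - t) - f x) 2 P) ^ 2 := by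
        rw [← eLpNorm_one_eq_lintegral_enorm]
        gcongr
        exact eLpNorm_le_eLpNorm_of_exponent_le (by norm_num) hfP
    _ = _ := by
        rw [← lintegral_enorm_sq_eq, hwd _ (hfm.enorm.pow_const 2)]

/-- Mollification with kernels supported near `0` is close to the identity in `L²`. -/
lemma exists_eLpNorm_mollify_sub_le [CompleteSpace W] {f : Planar d → W} (hf : MemLp f 2 volume)
    {η : ℝ} (hη : 0 < η) :
    ∃ τ > 0, ∀ ρ : Planar d → ℝ, Continuous ρ → HasCompactSupport ρ → (∀ x, 0 ≤ ρ x) →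
      ∫ x, ρ x = 1 → Function.support ρ ⊆ Metric.ball 0 τ →
      eLpNorm (fun x => mollify ρ f x - f x) 2 volume ≤ ENNReal.ofReal η := by
  obtain ⟨τ, hτ, h⟩ := exists_eLpNorm_translate_sub_le hf hη
  refine ⟨τ, hτ, fun ρ hρ hc h0 h1 hs => ?_⟩
  have hfl : LocallyIntegrable f := hf.locallyIntegrable (by norm_num)
  have hρi : Integrable ρ := hρ.integrable_of_hasCompactSupport hc
  have hm : AEMeasurable (fun p : Planar d × Planar d =>
      ENNReal.ofReal (ρ p.2) * ‖f (p.1 - p.2) - f p.1‖ₑ ^ 2) (volume.prod volume) := by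
    have e1 : AEStronglyMeasurable (fun p : Planar d × Planar d => f (p.1 - p.2))
        (volume.prod volume) := hf.1.comp_quasiMeasurePreserving
      (quasiMeasurePreserving_sub_of_right_invariant volume volume)
    have e2 : AEMeasurable (fun p : Planar d × Planar d => ENNReal.ofReal (ρ p.2))
        (volume.prod volume) := by fun_prop
    exact e2.mul ((e1.sub hf.1.comp_fst).enorm.pow_const 2)
  rw [← ENNReal.pow_le_pow_left_iff two_ne_zero, ← lintegral_enorm_sq_eq]
  calc _ ≤ ∫⁻ x, ∫⁻ t, ENNReal.ofReal (ρ t) * ‖f (x - t) - f x‖ₑ ^ 2 :=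
        lintegral_mono fun x => enorm_mollify_sub_sq_le hρ hc h0 h1 hfl x
    _ = ∫⁻ t, ∫⁻ x, ENNReal.ofReal (ρ t) * ‖f (x - t) - f x‖ₑ ^ 2 := lintegral_lintegral_swap hm
    _ ≤ ∫⁻ t, ENNReal.ofReal (ρ t) * ENNReal.ofReal η ^ 2 := by
        refine lintegral_mono fun t => ?_
        rw [lintegral_const_mul' _ _ ENNReal.ofReal_ne_top]
        by_cases ht : ρ t = 0
        · simp [ht]
        · rw [lintegral_enorm_sq_eq]
          gcongr
          exact h t (by simpa using hs ht)
    _ = _ := by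
        rw [lintegral_mul_const' _ _ (by simp),
          ← ofReal_integral_eq_lintegral_ofReal hρi (.of_forall h0), h1, ENNReal.ofReal_one, one_mul]

end Mollification

/-! ### Gradients of mollified Sobolev functions. -/

section MollifiedGradient

open ContinuousLinearMap in
lemma mollify_eq_convolution (ρ f : Planar d → ℝ) :
    mollify ρ f = convolution f ρ (lsmul ℝ ℝ) volume := by
  ext x
  simp only [mollify, convolution_def, lsmul_apply, smul_eq_mul, mul_comm]

lemma contDiff_mollify {ρ f : Planar d → ℝ} (hρ : ContDiff ℝ (⊤ : ℕ∞) ρ) (hc : HasCompactSupport ρ)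
    (hf : LocallyIntegrable f) : ContDiff ℝ (⊤ : ℕ∞) (mollify ρ f) := by
  rw [mollify_eq_convolution]
  exact hc.contDiff_convolution_right _ hf hρ

lemma hasCompactSupport_mollify {ρ f : Planar d → ℝ} (hc : HasCompactSupport ρ)
    (hf : HasCompactSupport f) : HasCompactSupport (mollify ρ f) := by
  rw [mollify_eq_convolution]
  exact hf.convolution _ hc

/-- The derivative falls on the kernel, so f need only be locally integrable. -/
lemma fderiv_mollify_apply {ρ f : Planar d → ℝ} (hρ : ContDiff ℝ (⊤ : ℕ∞) ρ)
    (hc : HasCompactSupport ρ) (hf : LocallyIntegrable f) (x v : Planar d) :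
    fderiv ℝ (mollify ρ f) x v = ∫ t, f t * fderiv ℝ ρ (x - t) v := by
  rw [mollify_eq_convolution,
    (hc.hasFDerivAt_convolution_right _ hf (hρ.of_le (by simp)) x).fderiv,
    convolution_precompR_apply _ hf (hc.fderiv ℝ) (hρ.continuous_fderiv (by simp)) x v]
  rfl

/-- The gradient of the mollification of a localized Sobolev function, at the points where the
kernel only sees `ω`. -/
lemma grad_mollify {ω : Set (Planar d)} {u : Planar d → ℝ} {G : Planar d → Planar d}
    (hu : Integrable u) (hG : Integrable G)
    (hw : ∀ φ : Planar d → ℝ, ContDiff ℝ (⊤ : ℕ∞) φ → HasCompactSupport φ → tsupport φ ⊆ ω →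
      ∀ v, ∫ x, u x * fderiv ℝ φ x v = - ∫ x, inner ℝ (G x) v * φ x)
    {ρ χ : Planar d → ℝ} (hρ : ContDiff ℝ (⊤ : ℕ∞) ρ) (hρc : HasCompactSupport ρ)
    (hχ : ContDiff ℝ (⊤ : ℕ∞) χ) (hχc : HasCompactSupport χ) {x : Planar d}
    (hx : ∀ t ∈ tsupport χ, x - t ∈ tsupport ρ → t ∈ ω) :
    grad (mollify ρ fun t => χ t * u t) x = mollify ρ (fun t => χ t • G t + u t • grad χ t) x := by
  obtain ⟨B, hB⟩ := hχc.exists_bound_of_continuous hχ.continuous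
  have hgc := continuous_grad (hχ.of_le (by simp) : ContDiff ℝ 1 χ)
  have hgs : HasCompactSupport (grad χ) :=
    (hχc.fderiv ℝ).comp_left (g := (InnerProductSpace.toDual ℝ (Planar d)).symm) (by simp)
  obtain ⟨B', hB'⟩ := hgs.exists_bound_of_continuous hgc
  have hχu : Integrable fun t => χ t * u t :=
    hu.bdd_mul hχ.continuous.aestronglyMeasurable (.of_forall hB)
  have hχG : Integrable fun t => χ t • G t :=
    hG.bdd_smul B hχ.continuous.aestronglyMeasurable (.of_forall hB)
  have hug : Integrable fun t => u t • grad χ t :=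
    hu.smul_bdd B' hgc.aestronglyMeasurable (.of_forall hB')
  refine ext_inner_right ℝ fun v => ?_
  rw [inner_grad, fderiv_mollify_apply hρ hρc hχu.locallyIntegrable]
  have hρx : ContDiff ℝ (⊤ : ℕ∞) fun t => ρ (x - t) := by fun_prop
  -- The kernel seen from x, times the cutoff, is an admissible test function precisely because the
  -- kernel meets the support of χ only inside ω. The product rule then produces the term with the
  -- gradient of χ.
  set φ : Planar d → ℝ := fun t => ρ (x - t) * χ t with hφ
  have hφs : ContDiff ℝ (⊤ : ℕ∞) φ := hρx.mul hχ
  have hφc : HasCompactSupport φ := hχc.mul_left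
  have hφω : tsupport φ ⊆ ω := by
    have hcl : IsClosed {t | t ∈ tsupport χ ∧ x - t ∈ tsupport ρ} :=
      (isClosed_tsupport χ).inter ((isClosed_tsupport ρ).preimage (by fun_prop))
    refine (closure_minimal (fun t ht => ?_) hcl).trans fun t ht => hx t ht.1 ht.2
    have := mul_ne_zero_iff.1 ht
    exact ⟨subset_tsupport _ this.2, subset_tsupport _ this.1⟩
  have hfd : ∀ t, fderiv ℝ φ t v = -(χ t * fderiv ℝ ρ (x - t) v) + ρ (x - t) * inner ℝ (grad χ t) v := by
    intro t
    rw [hφ, fderiv_fun_mul (hρx.differentiable (by simp) t) (hχ.differentiable (by simp) t),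
      inner_grad]
    have : fderiv ℝ (fun t => ρ (x - t)) t = -fderiv ℝ ρ (x - t) := by
      have h1 : HasFDerivAt (fun t => x - t) (-ContinuousLinearMap.id ℝ (Planar d)) t :=
        (hasFDerivAt_id t).const_sub x
      have h2 := ((hρ.differentiable (by simp) (x - t)).hasFDerivAt.comp t h1).fderiv
      rw [Function.comp_def] at h2
      rw [h2]
      ext z
      simp
    simp [this]
    ring
  have key := hw φ hφs hφc hφω v
  have i1 : Integrable fun t => χ t * u t * fderiv ℝ ρ (x - t) v := by
    obtain ⟨B₁, hB₁⟩ := (hρc.fderiv ℝ).exists_bound_of_continuous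
      (hρ.continuous_fderiv (by simp))
    refine hχu.mul_bdd (c := B₁ * ‖v‖) ?_ (.of_forall fun t => ?_)
    · have := hρ.continuous_fderiv (by simp)
      exact (by fun_prop : Continuous fun t => fderiv ℝ ρ (x - t) v).aestronglyMeasurable
    · exact (ContinuousLinearMap.le_opNorm _ _).trans (by gcongr; exact hB₁ _)
  obtain ⟨B₂, hB₂⟩ := hρc.exists_bound_of_continuous hρ.continuous
  have i2 : Integrable fun t => ρ (x - t) * inner ℝ (u t • grad χ t) v :=
    (hug.inner_const v).bdd_mul hρx.continuous.aestronglyMeasurable (.of_forall fun t => hB₂ _)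
  have i3 : Integrable fun t => ρ (x - t) * inner ℝ (χ t • G t) v :=
    (hχG.inner_const v).bdd_mul hρx.continuous.aestronglyMeasurable (.of_forall fun t => hB₂ _)
  have i1n : Integrable fun t => -(χ t * u t * fderiv ℝ ρ (x - t) v) := i1.neg
  have hχGu : Integrable fun t => χ t • G t + u t • grad χ t := hχG.add hug
  have hleft : ∫ t, u t * fderiv ℝ φ t v =
      -(∫ t, χ t * u t * fderiv ℝ ρ (x - t) v) + ∫ t, ρ (x - t) * inner ℝ (u t • grad χ t) v := by
    rw [← integral_neg, ← integral_add i1n i2]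
    congr with t
    rw [hfd, inner_smul_left]
    simp
    ring
  have hright : ∫ t, inner ℝ (G t) v * φ t = ∫ t, ρ (x - t) * inner ℝ (χ t • G t) v := by
    congr with t
    rw [hφ, inner_smul_left]
    simp
    ring
  have hmain : inner ℝ (mollify ρ (fun t => χ t • G t + u t • grad χ t) x) v =
      (∫ t, ρ (x - t) * inner ℝ (χ t • G t) v) + ∫ t, ρ (x - t) * inner ℝ (u t • grad χ t) v := by
    rw [mollify, real_inner_comm, ← integral_inner
      (integrable_mollify_integrand hρ.continuous hρc hχGu.locallyIntegrable x),
      ← integral_add i3 i2]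
    congr with t
    rw [real_inner_comm, inner_smul_left, inner_add_left]
    simp
    ring
  rw [hmain]
  linarith

end MollifiedGradient

end

/-! ### Density of smooth functions in H¹ of a Lipschitz domain. -/

section

variable {d : ℕ}

lemma continuous_mollify {W : Type*} [NormedAddCommGroup W] [NormedSpace ℝ W]
    {ρ : Planar d → ℝ} (hρ : Continuous ρ) (hc : HasCompactSupport ρ)
    {f : Planar d → W} (hf : LocallyIntegrable f) : Continuous (mollify ρ f) := by
  have h : mollify ρ f = convolution f ρ (ContinuousLinearMap.lsmul ℝ ℝ).flip volume := by
    ext x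
    simp [mollify, convolution_def]
  rw [h]
  exact hc.continuous_convolution_right _ hf hρ

/-- Normalized bumps with prescribed support. -/
lemma exists_normalized_bump (c : Planar d) {R : ℝ} (hR : 0 < R) :
    ∃ ρ : Planar d → ℝ, ContDiff ℝ (⊤ : ℕ∞) ρ ∧ HasCompactSupport ρ ∧ (∀ x, 0 ≤ ρ x) ∧
      ∫ x, ρ x = 1 ∧ tsupport ρ = Metric.closedBall c R := by
  let f : ContDiffBump c := ⟨R / 2, R, by positivity, by linarith⟩
  exact ⟨f.normed volume, f.contDiff_normed, f.hasCompactSupport_normed, f.nonneg_normed,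
    f.integral_normed, f.tsupport_normed_eq⟩

/-- Near a point of the closure of a Lipschitz domain `ω` there are arbitrarily concentrated
mollifiers that, seen from the points of `ω`, charge only `ω`. -/
lemma exists_mollifier {ω : Set (Planar d)} (hω : IsOpen ω) (hlip : HasLipschitzBoundary ω)
    {x₀ : Planar d} (hx₀ : x₀ ∈ closure ω) :
    ∃ r > 0, ∀ τ > 0, ∃ ρ : Planar d → ℝ, ContDiff ℝ (⊤ : ℕ∞) ρ ∧ HasCompactSupport ρ ∧
      (∀ x, 0 ≤ ρ x) ∧ ∫ x, ρ x = 1 ∧ Function.support ρ ⊆ Metric.ball 0 τ ∧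
      ∀ x ∈ ω, ∀ t ∈ Metric.ball x₀ r, x - t ∈ tsupport ρ → t ∈ ω := by
  by_cases hx : x₀ ∈ ω
  · obtain ⟨r, hr, hrω⟩ := Metric.isOpen_iff.1 hω x₀ hx
    refine ⟨r, hr, fun τ hτ => ?_⟩
    obtain ⟨ρ, h1, h2, h3, h4, h5⟩ := exists_normalized_bump (0 : Planar d) (half_pos hτ)
    refine ⟨ρ, h1, h2, h3, h4, ?_, fun x _ t ht _ => hrω ht⟩
    refine (subset_tsupport ρ).trans ?_
    rw [h5]
    exact Metric.closedBall_subset_ball (by linarith)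
  · have hfr : x₀ ∈ frontier ω := by
      rw [frontier, hω.interior_eq]
      exact ⟨hx₀, hx⟩
    obtain ⟨r, hr, e, he, K, g, hg, hgω⟩ := hlip x₀ hfr
    refine ⟨r / 2, by positivity, fun τ hτ => ?_⟩
    -- The kernel is centred at -ae with radius ca, so t = x + ae - w with |w| ≤ ca. The height
    -- above the graph gains a, loses at most ca through w, and at most 2Kca through the Lipschitz
    -- function; c is chosen so that the losses total a/2.
    set c : ℝ := 1 / (2 * (1 + 2 * K)) with hc
    have hK : (0 : ℝ) ≤ K := K.2
    have hcpos : 0 < c := by positivity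
    have hcK : c * (1 + 2 * K) = 1 / 2 := by
      rw [hc]
      field_simp
    have hc1 : c ≤ 1 := by nlinarith
    -- The kernel lies within 2a of the origin: a ≤ τ/4 puts it in the ball of radius τ, and a ≤ r/8
    -- keeps x in the chart when t is in the half ball.
    set a : ℝ := min (τ / 4) (r / 8) with ha
    have hapos : 0 < a := by positivity
    have haτ : a ≤ τ / 4 := min_le_left _ _
    have har : a ≤ r / 8 := min_le_right _ _
    obtain ⟨ρ, h1, h2, h3, h4, h5⟩ := exists_normalized_bump (-(a • e)) (mul_pos hcpos hapos)
    have hnorm : ∀ z ∈ tsupport ρ, ‖z‖ ≤ 2 * a := by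
      intro z hz
      rw [h5, mem_closedBall_iff_norm, sub_neg_eq_add] at hz
      have h6 : ‖a • e‖ = a := by rw [norm_smul, he, mul_one, Real.norm_of_nonneg hapos.le]
      calc ‖z‖ = ‖(z + a • e) - a • e‖ := by simp
        _ ≤ ‖z + a • e‖ + ‖a • e‖ := norm_sub_le _ _
        _ ≤ 2 * a := by rw [h6]; nlinarith
    refine ⟨ρ, h1, h2, h3, h4, fun z hz => ?_, fun x hxω t ht hxt => ?_⟩
    · rw [mem_ball_zero_iff]
      linarith [hnorm z (subset_tsupport _ hz)]
    · have hxr : x ∈ Metric.ball x₀ r := by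
        have := hnorm _ hxt
        rw [mem_ball_iff_norm] at ht ⊢
        calc ‖x - x₀‖ = ‖(x - t) + (t - x₀)‖ := by simp
          _ ≤ ‖x - t‖ + ‖t - x₀‖ := norm_add_le _ _
          _ < r := by linarith
      have htr : t ∈ Metric.ball x₀ r := Metric.ball_subset_ball (by linarith) ht
      rw [hgω t htr]
      have hgx := (hgω x hxr).1 hxω
      rw [h5, mem_closedBall_iff_norm, sub_neg_eq_add] at hxt
      set w := x - t + a • e with hw
      have htw : t = x + a • e - w := by rw [hw]; abel
      have hew : |inner ℝ e w| ≤ c * a := by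
        refine (abs_real_inner_le_norm e w).trans ?_
        rwa [he, one_mul]
      have hee : inner ℝ e e = (1 : ℝ) := by rw [real_inner_self_eq_norm_sq, he]; norm_num
      have het : inner ℝ e t = inner ℝ e x + a - inner ℝ e w := by
        rw [htw, inner_sub_right, inner_add_right, inner_smul_right, hee, mul_one]
      have hproj : t - (inner ℝ e t : ℝ) • e =
          (x - (inner ℝ e x : ℝ) • e) - (w - (inner ℝ e w : ℝ) • e) := by
        rw [het, htw]
        module
      have hgd := hg.dist_le_mul (t - (inner ℝ e t : ℝ) • e) (x - (inner ℝ e x : ℝ) • e)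
      have hdist : dist (t - (inner ℝ e t : ℝ) • e) (x - (inner ℝ e x : ℝ) • e) ≤ 2 * (c * a) := by
        rw [dist_eq_norm, hproj, sub_sub_cancel_left, norm_neg]
        calc _ ≤ ‖w‖ + ‖(inner ℝ e w : ℝ) • e‖ := norm_sub_le _ _
          _ ≤ 2 * (c * a) := by
            rw [norm_smul, he, mul_one, Real.norm_eq_abs]
            linarith
      rw [Real.dist_eq] at hgd
      have h7 := le_abs_self (g (t - (inner ℝ e t : ℝ) • e) - g (x - (inner ℝ e x : ℝ) • e))
      have h8 := (abs_le.1 hew).2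
      have h9 : (K : ℝ) * dist (t - (inner ℝ e t : ℝ) • e) (x - (inner ℝ e x : ℝ) • e) ≤
          K * (2 * (c * a)) := by gcongr
      have h10 : c * a + K * (2 * (c * a)) = a / 2 := by
        calc _ = c * (1 + 2 * K) * a := by ring
          _ = _ := by rw [hcK]; ring
      linarith

/-- A finite smooth partition of unity subordinate to balls with prescribed radii. -/
lemma exists_finite_partition {S : Set (Planar d)} (hS : IsCompact S) (r : Planar d → ℝ)
    (hr : ∀ x ∈ S, 0 < r x) :
    ∃ (t : Finset (Planar d)) (χ : Planar d → Planar d → ℝ), (∀ i ∈ t, i ∈ S) ∧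
      (∀ i ∈ t, ContDiff ℝ (⊤ : ℕ∞) (χ i)) ∧ (∀ i ∈ t, tsupport (χ i) ⊆ Metric.ball i (r i)) ∧
      ∀ x ∈ S, ∑ i ∈ t, χ i x = 1 := by
  obtain ⟨t, htS, ht⟩ := hS.elim_nhds_subcover (fun x => Metric.ball x (r x))
    (fun x hx => Metric.ball_mem_nhds x (hr x hx))
  obtain ⟨f, hf⟩ := SmoothPartitionOfUnity.exists_isSubordinate
    (modelWithCornersSelf ℝ (Planar d)) hS.isClosed
    (fun i : t => Metric.ball (i : Planar d) (r i)) (fun i => Metric.isOpen_ball)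
    (by simpa [iUnion_subtype] using ht)
  classical
  refine ⟨t, fun i => if h : i ∈ t then f ⟨i, h⟩ else 0, htS, fun i hi => ?_, fun i hi => ?_,
    fun x hx => ?_⟩
  · simp only [hi, dif_pos]
    exact (f ⟨i, hi⟩).contMDiff.contDiff
  · simp only [hi, dif_pos]
    exact hf ⟨i, hi⟩
  · have := f.sum_eq_one hx
    rw [finsum_eq_sum_of_fintype, ← Finset.sum_attach t] at *
    rw [← this]
    refine Finset.sum_congr rfl fun i _ => ?_
    simp

lemma grad_sum {ι : Type*} (t : Finset ι) {v : ι → Planar d → ℝ} {x : Planar d}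
    (hv : ∀ i ∈ t, DifferentiableAt ℝ (v i) x) :
    grad (fun x => ∑ i ∈ t, v i x) x = ∑ i ∈ t, grad (v i) x := by
  simp only [grad]
  rw [fderiv_fun_sum hv, map_sum]

/-- Functions of `H¹(ω)` on a Lipschitz domain are approximated by restrictions of smooth
functions. -/
theorem exists_contDiff_eLpNorm_grad_sub_le {ω : Set (Planar d)} (hω : IsOpen ω)
    (hbdd : Bornology.IsBounded ω) (hlip : HasLipschitzBoundary ω) {u : Planar d → ℝ}
    {G : Planar d → Planar d} (hu : IsH1WithGradient ω u G) {η : ℝ} (hη : 0 < η) :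
    ∃ v : Planar d → ℝ, ContDiff ℝ (⊤ : ℕ∞) v ∧ HasCompactSupport v ∧
      eLpNorm (fun x => v x - u x) 2 (volume.restrict ω) ≤ ENNReal.ofReal η ∧
      eLpNorm (fun x => grad v x - G x) 2 (volume.restrict ω) ≤ ENNReal.ofReal η := by
  have hωm := hω.measurableSet
  have hωfin : volume ω ≠ ⊤ := hbdd.measure_lt_top.ne
  have : IsFiniteMeasure (volume.restrict ω) := isFiniteMeasure_restrict.2 hωfin
  set u' := ω.indicator u with hu'
  set G' := ω.indicator G with hG'
  have hu2 : MemLp u' 2 volume := (memLp_indicator_iff_restrict hωm).2 hu.memLp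
  have hG2 : MemLp G' 2 volume := (memLp_indicator_iff_restrict hωm).2 hu.memLp_gradient
  have hu1 : Integrable u' := by
    rw [hu', integrable_indicator_iff hωm]
    exact hu.memLp.integrable (by norm_num)
  have hG1 : Integrable G' := by
    rw [hG', integrable_indicator_iff hωm]
    exact hu.memLp_gradient.integrable (by norm_num)
  have huc : HasCompactSupport u' :=
    HasCompactSupport.of_support_subset_isCompact hbdd.isCompact_closure
      (support_indicator_subset.trans subset_closure)
  have hex : ∀ x : Planar d, ∃ r : ℝ, x ∈ closure ω → 0 < r ∧ ∀ τ > 0, ∃ ρ : Planar d → ℝ,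
      ContDiff ℝ (⊤ : ℕ∞) ρ ∧ HasCompactSupport ρ ∧
      (∀ x, 0 ≤ ρ x) ∧ ∫ x, ρ x = 1 ∧ Function.support ρ ⊆ Metric.ball 0 τ ∧
      ∀ y ∈ ω, ∀ t ∈ Metric.ball x r, y - t ∈ tsupport ρ → t ∈ ω := by
    intro x
    by_cases hx : x ∈ closure ω
    · obtain ⟨r, hr, h⟩ := exists_mollifier hω hlip hx
      exact ⟨r, fun _ => ⟨hr, h⟩⟩
    · exact ⟨0, fun h => absurd h hx⟩
  choose r hr using hex
  obtain ⟨t, χ, htS, hχs, hχr, hχ1⟩ := exists_finite_partition hbdd.isCompact_closure r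
    fun x hx => (hr x hx).1
  have hχc : ∀ i ∈ t, HasCompactSupport (χ i) := fun i hi =>
    Metric.isCompact_of_isClosed_isBounded (isClosed_tsupport _)
      (Metric.isBounded_ball.subset (hχr i hi))
  set f : Planar d → Planar d → ℝ := fun i x => χ i x * u' x with hf
  set H : Planar d → Planar d → Planar d := fun i x => χ i x • G' x + u' x • grad (χ i) x with hH
  have hgc : ∀ i ∈ t, Continuous (grad (χ i)) := fun i hi =>
    continuous_grad ((hχs i hi).of_le (by simp))
  have hf2 : ∀ i ∈ t, MemLp (f i) 2 volume := by
    intro i hi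
    obtain ⟨B, hB⟩ := (hχc i hi).exists_bound_of_continuous (hχs i hi).continuous
    refine hu2.of_le_mul ((hχs i hi).continuous.aestronglyMeasurable.mul hu2.1) (c := B)
      (.of_forall fun x => ?_)
    rw [norm_mul]
    gcongr
    exact hB x
  have hH2 : ∀ i ∈ t, MemLp (H i) 2 volume := by
    intro i hi
    obtain ⟨B, hB⟩ := (hχc i hi).exists_bound_of_continuous (hχs i hi).continuous
    have hgs : HasCompactSupport (grad (χ i)) :=
      ((hχc i hi).fderiv ℝ).comp_left (g := (InnerProductSpace.toDual ℝ (Planar d)).symm) (by simp)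
    obtain ⟨B', hB'⟩ := hgs.exists_bound_of_continuous (hgc i hi)
    refine MemLp.add ?_ ?_
    · refine hG2.of_le_mul ((hχs i hi).continuous.aestronglyMeasurable.smul hG2.1) (c := B)
        (.of_forall fun x => ?_)
      rw [norm_smul]
      gcongr
      exact hB x
    · refine hu2.of_le_mul (hu2.1.smul (hgc i hi).aestronglyMeasurable) (c := B')
        (.of_forall fun x => ?_)
      rw [norm_smul, mul_comm]
      gcongr
      exact hB' x
  -- An equal share of the error for each chart; the added 1 covers an empty partition.
  set e := η / (t.card + 1) with he
  have hepos : 0 < e := by positivity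
  have hsum : ∑ _i ∈ t, ENNReal.ofReal e ≤ ENNReal.ofReal η := by
    rw [← ENNReal.ofReal_sum_of_nonneg fun _ _ => hepos.le]
    apply ENNReal.ofReal_le_ofReal
    rw [Finset.sum_const, nsmul_eq_mul, he, mul_div_assoc', div_le_iff₀ (by positivity)]
    nlinarith
  have hker : ∀ i : Planar d, ∃ ρ : Planar d → ℝ, i ∈ t → ContDiff ℝ (⊤ : ℕ∞) ρ ∧
      HasCompactSupport ρ ∧ (∀ y ∈ ω, ∀ t ∈ Metric.ball i (r i), y - t ∈ tsupport ρ → t ∈ ω) ∧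
      eLpNorm (fun x => mollify ρ (f i) x - f i x) 2 volume ≤ ENNReal.ofReal e ∧
      eLpNorm (fun x => mollify ρ (H i) x - H i x) 2 volume ≤ ENNReal.ofReal e := by
    intro i
    by_cases hi : i ∈ t
    · obtain ⟨τ₁, hτ₁, h1⟩ := exists_eLpNorm_mollify_sub_le (hf2 i hi) hepos
      obtain ⟨τ₂, hτ₂, h2⟩ := exists_eLpNorm_mollify_sub_le (hH2 i hi) hepos
      obtain ⟨ρ, hρ, hρc, hρ0, hρ1, hρs, hρω⟩ := (hr i (htS i hi)).2 (min τ₁ τ₂) (lt_min hτ₁ hτ₂)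
      exact ⟨ρ, fun _ => ⟨hρ, hρc, hρω,
        h1 ρ hρ.continuous hρc hρ0 hρ1 (hρs.trans (Metric.ball_subset_ball (min_le_left _ _))),
        h2 ρ hρ.continuous hρc hρ0 hρ1 (hρs.trans (Metric.ball_subset_ball (min_le_right _ _)))⟩⟩
    · exact ⟨0, fun h => absurd h hi⟩
  choose ρ hρ using hker
  have hfl : ∀ i ∈ t, LocallyIntegrable (f i) := fun i hi =>
    (hf2 i hi).locallyIntegrable (by norm_num)
  have hHl : ∀ i ∈ t, LocallyIntegrable (H i) := fun i hi =>
    (hH2 i hi).locallyIntegrable (by norm_num)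
  have hsm : ∀ i ∈ t, ContDiff ℝ (⊤ : ℕ∞) (mollify (ρ i) (f i)) := fun i hi =>
    contDiff_mollify (hρ i hi).1 (hρ i hi).2.1 (hfl i hi)
  refine ⟨fun x => ∑ i ∈ t, mollify (ρ i) (f i) x, ContDiff.sum hsm, ?_, ?_, ?_⟩
  · have hcs : ∀ i ∈ t, HasCompactSupport (mollify (ρ i) (f i)) := fun i hi =>
      hasCompactSupport_mollify (hρ i hi).2.1 huc.mul_left
    have : IsCompact (⋃ i ∈ t, tsupport (mollify (ρ i) (f i))) :=
      t.isCompact_biUnion fun i hi => hcs i hi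
    refine HasCompactSupport.intro this fun x hx => Finset.sum_eq_zero fun i hi => ?_
    refine image_eq_zero_of_notMem_tsupport fun h => hx ?_
    exact mem_biUnion (Finset.mem_coe.2 hi) h
  · have heq : ∀ x ∈ ω, (∑ i ∈ t, mollify (ρ i) (f i) x) - u x =
        (∑ i ∈ t, fun x => mollify (ρ i) (f i) x - f i x) x := by
      intro x hx
      rw [Finset.sum_apply, Finset.sum_sub_distrib, hf]
      simp only
      rw [← Finset.sum_mul, hχ1 x (subset_closure hx), one_mul, hu', indicator_of_mem hx]
    rw [eLpNorm_congr_ae ((ae_restrict_iff' hωm).2 (.of_forall heq))]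
    refine (eLpNorm_mono_measure _ Measure.restrict_le_self).trans
      ((eLpNorm_sum_le (fun i hi => ?_) (by norm_num)).trans
        ((Finset.sum_le_sum fun i hi => (hρ i hi).2.2.2.1).trans hsum))
    exact (hsm i hi).continuous.aestronglyMeasurable.sub (hf2 i hi).1
  · have heq : ∀ x ∈ ω, grad (fun x => ∑ i ∈ t, mollify (ρ i) (f i) x) x - G x =
        (∑ i ∈ t, fun x => mollify (ρ i) (H i) x - H i x) x := by
      intro x hx
      have h1 : ∑ i ∈ t, H i x = G x := by
        -- The partition sums to 1 on the open set ω, so the gradients of the cutoffs cancel there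
        -- and the localized fields add up to G.
        have hg0 : ∑ i ∈ t, grad (χ i) x = 0 := by
          rw [← grad_sum t fun i hi => (hχs i hi).differentiable (by simp) x]
          have hev : (fun x => ∑ i ∈ t, χ i x) =ᶠ[𝓝 x] fun _ => 1 := by
            filter_upwards [hω.mem_nhds hx] with y hy using hχ1 y (subset_closure hy)
          rw [grad, hev.fderiv_eq]
          simp
        simp only [hH]
        rw [Finset.sum_add_distrib, ← Finset.sum_smul, ← Finset.smul_sum, hg0,
          hχ1 x (subset_closure hx), one_smul, smul_zero, add_zero, hG', indicator_of_mem hx]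
      rw [Finset.sum_apply, Finset.sum_sub_distrib, h1,
        grad_sum t fun i hi => (hsm i hi).differentiable (by simp) x]
      congr 1
      refine Finset.sum_congr rfl fun i hi => ?_
      exact grad_mollify (ω := ω) hu1 hG1
        (fun φ h1 h2 h3 v => hu.integral_indicator_eq hωm h1 h2 h3 v)
        (hρ i hi).1 (hρ i hi).2.1 (hχs i hi) (hχc i hi)
        (fun y hy hxy => (hρ i hi).2.2.1 x hx y (hχr i hi hy) hxy)
    rw [eLpNorm_congr_ae ((ae_restrict_iff' hωm).2 (.of_forall heq))]
    refine (eLpNorm_mono_measure _ Measure.restrict_le_self).trans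
      ((eLpNorm_sum_le (fun i hi => ?_) (by norm_num)).trans
        ((Finset.sum_le_sum fun i hi => (hρ i hi).2.2.2.2).trans hsum))
    exact (continuous_mollify (hρ i hi).1.continuous (hρ i hi).2.1
      (hHl i hi)).aestronglyMeasurable.sub (hH2 i hi).1

end

/-! ### Diagonal extraction and recovery sequences. -/

section

variable {d : ℕ}

/-- Diagonal extraction. -/
lemma exists_tendsto_atTop_eventually {P : ℕ → ℕ → Prop} (h : ∀ m, ∀ᶠ j in atTop, P m j) :
    ∃ k : ℕ → ℕ, Tendsto k atTop atTop ∧ ∀ᶠ j in atTop, P (k j) j := by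
  choose N hN using fun m => eventually_atTop.1 (h m)
  classical
  -- The index at time j is the largest m ≤ j whose threshold has been passed; once j ≥ N 0 such an
  -- m exists, so the default value 0 of the search does no harm.
  refine ⟨fun j => Nat.findGreatest (fun m => N m ≤ j) j, ?_, ?_⟩
  · refine tendsto_atTop.2 fun M => ?_
    filter_upwards [eventually_ge_atTop M, eventually_ge_atTop (N M)] with j h1 h2
    exact Nat.le_findGreatest h1 h2
  · filter_upwards [eventually_ge_atTop (N 0)] with j hj
    exact hN _ j (Nat.findGreatest_spec (P := fun m => N m ≤ j) (Nat.zero_le j) hj)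

/-- The cylinder has unit height, so the integral is at most an L¹ norm over ω, and Hölder's
inequality on a set of finite measure passes to L². -/
lemma setLIntegral_comp_fst_le {ω : Set (Planar d)} {v u : Planar d → ℝ}
    (hvu : AEStronglyMeasurable (fun x => v x - u x) (volume.restrict ω)) {K : Set (Full d)}
    (hK : K ⊆ film ω 1) :
    ∫⁻ x in K, ‖v x.1 - u x.1‖ₑ ≤
      eLpNorm (fun x => v x - u x) 2 (volume.restrict ω) * volume ω ^ (1 / 2 : ℝ) := by
  calc ∫⁻ x in K, ‖v x.1 - u x.1‖ₑ ≤ ∫⁻ x in film ω 1, ‖v x.1 - u x.1‖ₑ := lintegral_mono_set hK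
    _ = eLpNorm (fun x => v x - u x) 1 (volume.restrict ω) := by
        rw [film, Measure.volume_eq_prod, ← Measure.prod_restrict,
          lintegral_prod _ hvu.comp_fst.enorm, eLpNorm_one_eq_lintegral_enorm]
        simp
    _ ≤ _ := by
        refine (eLpNorm_le_eLpNorm_mul_rpow_measure_univ (p := 1) (q := 2) (by norm_num)
          hvu).trans (le_of_eq ?_)
        norm_num

/-- Existence of recovery sequences. -/
theorem exists_recovery_sequence (hd : 2 ≤ d) {ω : Set (Planar d)} (hω : IsOpen ω)
    (hbdd : Bornology.IsBounded ω) (hlip : HasLipschitzBoundary ω) {s : ℝ → ℝ}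
    (hs : Tendsto s (𝓝[>] 0) (𝓝[<] 1)) {u : Planar d → ℝ} {G : Planar d → Planar d}
    (hu : IsH1WithGradient ω u G) {ε : ℕ → ℝ} (hε : ∀ j, 0 < ε j) (hε0 : Tendsto ε atTop (𝓝 0)) :
    ∃ U : ℕ → Full d → ℝ, DRConvL1loc ω ε U u ∧
      limsup (fun j => scaledEnergy ω (s (ε j)) (ε j) (U j)) atTop ≤
        ENNReal.ofReal (sphereArea d / (2 * d)) * ∫⁻ x in ω, ‖G x‖ₑ ^ 2 := by
  have hωfin : volume ω ≠ ⊤ := hbdd.measure_lt_top.ne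
  have : IsFiniteMeasure (volume.restrict ω) := isFiniteMeasure_restrict.2 hωfin
  have hθ : ∀ m : ℕ, (0 : ℝ) < 1 / (m + 1) := fun m => by positivity
  choose v hvs hvc hvu hvG using fun m : ℕ =>
    exists_contDiff_eLpNorm_grad_sub_le hω hbdd hlip hu (hθ m)
  set θ : ℕ → ℝ≥0∞ := fun m => ENNReal.ofReal (1 / (m + 1)) with hθdef
  have hθ0 : Tendsto θ atTop (𝓝 0) := by
    rw [← ENNReal.ofReal_zero]
    exact ENNReal.tendsto_ofReal tendsto_one_div_add_atTop_nhds_zero_nat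
  set n := eLpNorm G 2 (volume.restrict ω) with hn
  have hntop : n ≠ ⊤ := hu.memLp_gradient.2.ne
  set c := ENNReal.ofReal (sphereArea d / (2 * d)) with hc
  obtain ⟨k, hk, hkP⟩ := exists_tendsto_atTop_eventually fun m =>
    eventually_scaledEnergy_comp_fst_le hd hω.measurableSet hωfin hs hε hε0
      ((hvs m).of_le (by simp)) (hvc m) (hθ m)
  have hθk : Tendsto (fun j => θ (k j)) atTop (𝓝 0) := hθ0.comp hk
  refine ⟨fun j x => v (k j) x.1, ⟨fun j => ?_, ?_, fun K _ hK => ?_⟩, ?_⟩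
  · exact ((hvs (k j)).continuous.comp continuous_fst).locallyIntegrable.locallyIntegrableOn _
  · exact IntegrableOn.locallyIntegrableOn (hu.memLp.integrable (by norm_num))
  · have hlim : Tendsto (fun j => θ (k j) * volume ω ^ (1 / 2 : ℝ)) atTop (𝓝 0) := by
      have := ENNReal.Tendsto.mul_const (b := volume ω ^ (1 / 2 : ℝ)) hθk
        (Or.inr (ENNReal.rpow_ne_top_of_nonneg (by norm_num) hωfin))
      rwa [zero_mul] at this
    refine tendsto_of_tendsto_of_tendsto_of_le_of_le tendsto_const_nhds hlim
      (fun _ => zero_le) fun j => ?_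
    refine (setLIntegral_comp_fst_le ((hvs (k j)).continuous.aestronglyMeasurable.sub
      hu.memLp.1) hK).trans ?_
    gcongr
    exact hvu (k j)
  · have hle : ∀ᶠ j in atTop, scaledEnergy ω (s (ε j)) (ε j) (fun x => v (k j) x.1) ≤
        c * (n + θ (k j)) ^ 2 + θ (k j) := by
      filter_upwards [hkP] with j hj
      refine hj.trans ?_
      rw [lintegral_enorm_sq_eq]
      gcongr
      have h1 : grad (v (k j)) = G + fun x => grad (v (k j)) x - G x := by
        ext1 x
        simp
      have h2 : AEStronglyMeasurable (fun x => grad (v (k j)) x - G x) (volume.restrict ω) :=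
        (continuous_grad ((hvs (k j)).of_le (by simp))).aestronglyMeasurable.sub
          hu.memLp_gradient.1
      rw [h1]
      exact (eLpNorm_add_le hu.memLp_gradient.1 h2 (by norm_num)).trans
        (add_le_add_right (hvG (k j)) _)
    have hlim : Tendsto (fun j => c * (n + θ (k j)) ^ 2 + θ (k j)) atTop
        (𝓝 (c * (n + 0) ^ 2 + 0)) :=
      (ENNReal.Tendsto.const_mul
        (((ENNReal.continuous_pow 2).tendsto _).comp (tendsto_const_nhds.add hθk))
        (Or.inr ENNReal.ofReal_ne_top)).add hθk
    refine (limsup_le_limsup hle).trans (le_of_eq ?_)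
    rw [hlim.limsup_eq, add_zero, add_zero, lintegral_enorm_sq_eq]

end

end ThinFilm

end

theorem theorem4p2 (d : ℕ) (hd : 2 ≤ d) (ω : Set (ThinFilm.Planar d))
    (hopen : IsOpen ω) (hconn : IsConnected ω) (hbdd : Bornology.IsBounded ω)
    (hlip : ThinFilm.HasLipschitzBoundary ω)
    (s : ℝ → ℝ) (hs : Tendsto s (𝓝[>] 0) (𝓝[<] 1))
    (u : ThinFilm.Planar d → ℝ) (G : ThinFilm.Planar d → ThinFilm.Planar d)
    (hu : ThinFilm.IsH1WithGradient ω u G) :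
    ThinFilm.IsGammaLimitAt (ThinFilm.DRConvL1loc ω)
      (fun ε => ThinFilm.scaledEnergy ω (s ε) ε) u
      (ENNReal.ofReal (ThinFilm.sphereArea d / (2 * d)) * ∫⁻ x in ω, ‖G x‖ₑ ^ 2) :=
  fun _ hε hε0 =>
    ⟨fun _ hU => ThinFilm.le_liminf_scaledEnergy (by omega) hopen hbdd hs hu hε hε0 hU,
      ThinFilm.exists_recovery_sequence hd hopen hbdd hlip hs hu hε hε0⟩
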